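/- All rings are commutative. For a Noetherian local ring $(A,\mathfrak{m}_A)$ let $\operatorname{edim} A$ denote its embedding dimension, i.e. the minimal number of generators of $\mathfrak{m}_A$. A Noetherian local ring $A$ is called a complete intersection if its $\mathfrak{m}_A$-adic completion is isomorphic to $Q/(f_1,\dots,f_r)$ for some regular local ring $Q$ and some $Q$-regular sequence $f_1,\dots,f_r$ (with $r\ge 0$). Let $(R,\mathfrak{m})$ and $(S,\mathfrak{n})$ be complete Noetherian local rings, and let $R\to S$ be a flat local ring homomorphism. Suppose that $\dim R=\dim S$ and that $\operatorname{edim} S-\operatorname{edim} R\le 1$. Then the closed fibre $S/\mathfrak{m}S$ is a complete intersection. -/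

import Mathlib

universe u

/-- The embedding dimension of a local ring: the minimal number of generators of its maximal
ideal. -/
noncomputable def embDim (R : Type u) [CommRing R] [IsLocalRing R] : ℕ :=
  (IsLocalRing.maximalIdeal R).spanFinrank

/-- A ring `A` is a (local) complete intersection ring if it is a Noetherian local ring whose
completion at the maximal ideal is isomorphic to the quotient of a regular local ring by an ideal
generated by a regular sequence. -/
class IsCompleteIntersectionLocalRing (A : Type u) [CommRing A] : Prop extends
    IsLocalRing A, IsNoetherianRing A where
  exists_regular_presentation :
    ∃ (Q : Type u) (_ : CommRing Q) (_ : IsRegularLocalRing Q) (rs : List Q),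
      RingTheory.Sequence.IsRegular Q rs ∧
      Nonempty (AdicCompletion (IsLocalRing.maximalIdeal A) A ≃+* (Q ⧸ Ideal.ofList rs))

open CategoryTheory IsLocalRing Pointwise RingTheory.Sequence

section ProjectiveDimension

lemma hasProjectiveDimensionLE_succ_iff {B : Type u} [CommRing B] {K P M : Type u}
    [AddCommGroup K] [Module B K] [AddCommGroup P] [Module B P] [AddCommGroup M] [Module B M]
    [Module.Projective B P] {f : K →ₗ[B] P} {g : P →ₗ[B] M} (hf : Function.Injective f)
    (hfg : Function.Exact f g) (hg : Function.Surjective g) (n : ℕ) :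
    HasProjectiveDimensionLE (ModuleCat.of B M) (n + 1) ↔
      HasProjectiveDimensionLE (ModuleCat.of B K) n := by
  let S : ShortComplex (ModuleCat.{u} B) :=
    ShortComplex.mk (ModuleCat.ofHom f) (ModuleCat.ofHom g) (by
      ext x
      exact hfg.apply_apply_eq_zero x)
  have hS : S.ShortExact := ModuleCat.shortComplex_shortExact S hfg hf hg
  have : Projective S.X₂ := (IsProjective.iff_projective P).mp inferInstance
  exact hS.hasProjectiveDimensionLT_X₃_iff n this

lemma hasProjectiveDimensionLE_zero_iff {B : Type u} [CommRing B] {M : Type u}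
    [AddCommGroup M] [Module B M] :
    HasProjectiveDimensionLE (ModuleCat.of B M) 0 ↔ Module.Projective B M := by
  rw [← projective_iff_hasProjectiveDimensionLE_zero, IsProjective.iff_projective]

variable {B : Type u} [CommRing B]

lemma QuotSMulTop.map_injective_of_exact {K P M : Type*} [AddCommGroup K] [Module B K]
    [AddCommGroup P] [Module B P] [AddCommGroup M] [Module B M] {f : K →ₗ[B] P} {g : P →ₗ[B] M}
    (hf : Function.Injective f) (hfg : Function.Exact f g) {x : B} (hM : IsSMulRegular M x) :
    Function.Injective (QuotSMulTop.map x f) := by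
  have h0 : Function.Exact (0 : K →ₗ[B] K) f := by
    intro y
    refine ⟨fun h ↦ ⟨0, ?_⟩, ?_⟩
    · simpa using (hf (h.trans (map_zero f).symm)).symm
    · rintro ⟨z, rfl⟩
      simp
  have := QuotSMulTop.map_first_exact_on_four_term_exact_of_isSMulRegular_last h0 hfg hM
  rw [injective_iff_map_eq_zero]
  intro y hy
  obtain ⟨z, rfl⟩ := (this y).mp hy
  simp

instance QuotSMulTop.projective {P : Type*} [AddCommGroup P] [Module B P] [Module.Projective B P]
    (x : B) : Module.Projective (B ⧸ Ideal.span {x}) (QuotSMulTop x P) :=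
  Module.Projective.of_equiv ((QuotSMulTop.equivQuotTensor x P).extendScalarsOfSurjective
    Ideal.Quotient.mk_surjective).symm

lemma hasProjectiveDimensionLE_quotSMulTop_succ_iff {K P M : Type u} [AddCommGroup K] [Module B K]
    [AddCommGroup P] [Module B P] [AddCommGroup M] [Module B M] [Module.Projective B P]
    {f : K →ₗ[B] P} {g : P →ₗ[B] M} (hf : Function.Injective f)
    (hfg : Function.Exact f g) (hg : Function.Surjective g) {x : B} (hM : IsSMulRegular M x)
    (n : ℕ) :
    HasProjectiveDimensionLE (ModuleCat.of (B ⧸ Ideal.span {x}) (QuotSMulTop x M)) (n + 1) ↔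
      HasProjectiveDimensionLE (ModuleCat.of (B ⧸ Ideal.span {x}) (QuotSMulTop x K)) n :=
  hasProjectiveDimensionLE_succ_iff
    (f := (QuotSMulTop.map x f).extendScalarsOfSurjective
      (S := B ⧸ Ideal.span {x}) Ideal.Quotient.mk_surjective)
    (g := (QuotSMulTop.map x g).extendScalarsOfSurjective
      (S := B ⧸ Ideal.span {x}) Ideal.Quotient.mk_surjective)
    (QuotSMulTop.map_injective_of_exact hf hfg hM) (QuotSMulTop.map_exact x hfg hg)
    (QuotSMulTop.map_surjective x hg) n

lemma hasProjectiveDimensionLE_quotSMulTop {x : B} (hx : IsSMulRegular B x) (n : ℕ) :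
    ∀ (M : Type u) [AddCommGroup M] [Module B M], IsSMulRegular M x →
      HasProjectiveDimensionLE (ModuleCat.of B M) n →
      HasProjectiveDimensionLE (ModuleCat.of (B ⧸ Ideal.span {x}) (QuotSMulTop x M)) n := by
  induction n with
  | zero =>
    intro M _ _ hM h
    rw [hasProjectiveDimensionLE_zero_iff] at h ⊢
    infer_instance
  | succ n ih =>
    intro M _ _ hM h
    let g : (M →₀ B) →ₗ[B] M := Finsupp.linearCombination B id
    have hg : Function.Surjective g := Finsupp.linearCombination_id_surjective B M
    have hfg := LinearMap.exact_subtype_ker_map g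
    have hP : IsSMulRegular (M →₀ B) x := fun a b hab ↦ by
      ext i
      exact hx (DFunLike.congr_fun hab i)
    rw [hasProjectiveDimensionLE_quotSMulTop_succ_iff (Submodule.injective_subtype _) hfg hg hM]
    exact ih _ (hP.submodule _ _)
      ((hasProjectiveDimensionLE_succ_iff (Submodule.injective_subtype _) hfg hg n).mp h)

variable [IsLocalRing B]

lemma mem_jacobson_bot_of_mem_maximalIdeal {B : Type*} [CommRing B] [IsLocalRing B] {x : B}
    (hx : x ∈ maximalIdeal B) :
    x ∈ (⊥ : Ideal B).jacobson := by
  rwa [IsLocalRing.jacobson_eq_maximalIdeal ⊥ bot_ne_top]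

lemma isLocalRing_quotient_of_le {I : Ideal B} (hI : I ≤ maximalIdeal B) :
    IsLocalRing (B ⧸ I) :=
  have : Nontrivial (B ⧸ I) := Ideal.Quotient.nontrivial_iff.mpr
    (ne_top_of_le_ne_top (maximalIdeal.isMaximal B).ne_top hI)
  .of_surjective' (Ideal.Quotient.mk I) Ideal.Quotient.mk_surjective

lemma span_singleton_le_maximalIdeal {x : B} (hx : x ∈ maximalIdeal B) :
    Ideal.span {x} ≤ maximalIdeal B := by
  simpa [Ideal.span_le] using hx

open TensorProduct in
lemma lTensor_residueField_injective_of_socle {z : B} (hz : z ≠ 0)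
    (hzm : ∀ a ∈ maximalIdeal B, z * a = 0) {K P : Type u} [AddCommGroup K] [Module B K]
    [AddCommGroup P] [Module B P] [Module.Free B K] [Module.Free B P] [Module.Finite B P]
    (f : K →ₗ[B] P)
    (hf : Function.Injective f) : Function.Injective (f.lTensor (ResidueField B)) := by
  rw [injective_iff_map_eq_zero]
  intro w hw
  obtain ⟨v, rfl⟩ := TensorProduct.mk_surjective B K (ResidueField B) residue_surjective w
  let bP := Module.Free.chooseBasis B P
  let bK := Module.Free.chooseBasis B K
  have h1 : ∀ i, bP.repr (f v) i ∈ maximalIdeal B := by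
    intro i
    have h2 : (1 : ResidueField B) ⊗ₜ[B] f v = 0 := by simpa using hw
    have h3 := congrArg (TensorProduct.rid B (ResidueField B) ∘
      ((bP.coord i).lTensor (ResidueField B))) h2
    simp only [Function.comp_apply, LinearMap.lTensor_tmul, TensorProduct.rid_tmul,
      map_zero] at h3
    rw [← residue_eq_zero_iff]
    simpa [Algebra.smul_def] using h3
  have h4 : z • v = 0 := by
    apply hf
    rw [map_smul, map_zero]
    apply bP.repr.injective
    ext i
    simpa using hzm _ (h1 i)
  have h5 : ∀ i, bK.repr v i ∈ maximalIdeal B := by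
    intro i
    by_contra hi
    have hu : IsUnit (bK.repr v i) := by simpa using hi
    have := DFunLike.congr_fun (congrArg bK.repr h4) i
    simp only [map_smul, Finsupp.smul_apply, smul_eq_mul, map_zero, Finsupp.zero_apply] at this
    exact hz ((hu.mul_left_eq_zero).mp this)
  rw [TensorProduct.mk_apply, ← bK.linearCombination_repr v, Finsupp.linearCombination_apply,
    Finsupp.sum, TensorProduct.tmul_sum]
  refine Finset.sum_eq_zero fun i _ ↦ ?_
  rw [← TensorProduct.smul_tmul, Algebra.smul_def, mul_one]
  have : algebraMap B (ResidueField B) (bK.repr v i) = 0 := (residue_eq_zero_iff _).mpr (h5 i)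
  rw [this, zero_tmul]

variable [IsNoetherianRing B]

lemma free_of_projective_quotSMulTop {x : B} (hxm : x ∈ maximalIdeal B) (M : Type u)
    [AddCommGroup M] [Module B M] [Module.Finite B M] (hM : IsSMulRegular M x)
    (h : Module.Projective (B ⧸ Ideal.span {x}) (QuotSMulTop x M)) : Module.Free B M := by
  have := isLocalRing_quotient_of_le (span_singleton_le_maximalIdeal hxm)
  have : Module.Finite (B ⧸ Ideal.span {x}) (QuotSMulTop x M) :=
    Module.Finite.of_restrictScalars_finite B _ _
  have : Module.Free (B ⧸ Ideal.span {x}) (QuotSMulTop x M) :=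
    Module.free_of_flat_of_isLocalRing
  have hfp : Module.FinitePresentation B M := Module.finitePresentation_of_finite B M
  exact (Module.free_quotSMulTop_iff_free B M (mem_jacobson_bot_of_mem_maximalIdeal hxm) hM).mp this

lemma hasProjectiveDimensionLE_of_quotSMulTop {x : B} (hx : IsSMulRegular B x)
    (hxm : x ∈ maximalIdeal B) (n : ℕ) :
    ∀ (M : Type u) [AddCommGroup M] [Module B M] [Module.Finite B M], IsSMulRegular M x →
      HasProjectiveDimensionLE (ModuleCat.of (B ⧸ Ideal.span {x}) (QuotSMulTop x M)) n →
      HasProjectiveDimensionLE (ModuleCat.of B M) n := by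
  induction n with
  | zero =>
    intro M _ _ _ hM h
    rw [hasProjectiveDimensionLE_zero_iff] at h ⊢
    have := free_of_projective_quotSMulTop hxm M hM h
    infer_instance
  | succ n ih =>
    intro M _ _ _ hM h
    obtain ⟨k, g, hg⟩ := Module.Finite.exists_fin' B M
    have hfg := LinearMap.exact_subtype_ker_map g
    have hP : IsSMulRegular (Fin k → B) x := fun a b hab ↦ by
      ext i
      exact hx (congrFun hab i)
    rw [hasProjectiveDimensionLE_succ_iff (Submodule.injective_subtype _) hfg hg]
    exact ih _ (hP.submodule _ _)
      ((hasProjectiveDimensionLE_quotSMulTop_succ_iff (Submodule.injective_subtype _) hfg hg hM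
        n).mp h)

/-- Over a local ring of depth zero, a finitely generated module of finite projective dimension is
free. -/
lemma free_of_hasProjectiveDimensionLE_of_socle {z : B} (hz : z ≠ 0)
    (hzm : ∀ a ∈ maximalIdeal B, z * a = 0) (n : ℕ) :
    ∀ (M : Type u) [AddCommGroup M] [Module B M] [Module.Finite B M],
      HasProjectiveDimensionLE (ModuleCat.of B M) n → Module.Free B M := by
  induction n with
  | zero =>
    intro M _ _ _ h
    rw [hasProjectiveDimensionLE_zero_iff] at h
    exact Module.free_of_flat_of_isLocalRing
  | succ n ih =>
    intro M _ _ _ h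
    obtain ⟨k, g, hg⟩ := Module.Finite.exists_fin' B M
    have hfg := LinearMap.exact_subtype_ker_map g
    have := ih _
      ((hasProjectiveDimensionLE_succ_iff (Submodule.injective_subtype _) hfg hg n).mp h)
    exact Module.free_of_lTensor_residueField_injective _ g hg hfg
      (lTensor_residueField_injective_of_socle hz hzm _ (Submodule.injective_subtype _))

end ProjectiveDimension

section RegularLocalRing

lemma exists_finset_span_maximalIdeal_of_notMem_sq {R : Type*} [CommRing R] [IsLocalRing R]
    [IsNoetherianRing R] {x : R} (hx : x ∈ maximalIdeal R) (hx2 : x ∉ maximalIdeal R ^ 2) :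
    ∃ s : Finset R, x ∈ s ∧ s.card ≤ (maximalIdeal R).spanFinrank ∧
      Ideal.span (s : Set R) = maximalIdeal R := by
  classical
  let v : CotangentSpace R := (maximalIdeal R).toCotangent ⟨x, hx⟩
  have hv : v ≠ 0 := fun h ↦ hx2 (((maximalIdeal R).toCotangent_eq_zero _).mp h)
  have hli : LinearIndepOn (ResidueField R) id ({v} : Set (CotangentSpace R)) :=
    LinearIndepOn.singleton hv
  let b := Module.Basis.extend hli
  have hvmem : v ∈ hli.extend (Set.subset_univ _) := hli.subset_extend _ rfl
  have hfin : Finite (hli.extend (Set.subset_univ _)) := Module.Finite.finite_basis b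
  have : Fintype (hli.extend (Set.subset_univ _)) := Fintype.ofFinite _
  obtain ⟨σ, hσ⟩ : ∃ σ : CotangentSpace R → maximalIdeal R,
      σ v = ⟨x, hx⟩ ∧ ∀ w, (maximalIdeal R).toCotangent (σ w) = w := by
    refine ⟨Function.update (Function.surjInv (maximalIdeal R).toCotangent_surjective) v ⟨x, hx⟩,
      by simp, fun w ↦ ?_⟩
    by_cases hw : w = v
    · subst hw; simp [v]
    · simp only [Function.update_of_ne hw]
      exact Function.surjInv_eq _ w
  have hspan : Submodule.span R (σ '' hli.extend (Set.subset_univ _)) = ⊤ := by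
    rw [← CotangentSpace.span_image_eq_top_iff, ← Set.image_comp]
    have : ((maximalIdeal R).toCotangent ∘ σ) = id := funext hσ.2
    rw [this, Set.image_id, ← b.span_eq, Module.Basis.range_extend]
  refine ⟨(hli.extend (Set.subset_univ _)).toFinset.image (fun w ↦ (σ w : R)), ?_, ?_, ?_⟩
  · simp only [Finset.mem_image, Set.mem_toFinset]
    exact ⟨v, hvmem, by rw [hσ.1]⟩
  · refine Finset.card_image_le.trans (le_of_eq ?_)
    rw [spanFinrank_maximalIdeal_eq_finrank_cotangentSpace, Module.finrank_eq_card_basis b,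
      Set.toFinset_card]
  · have := congrArg (Submodule.map (maximalIdeal R).subtype) hspan
    rw [Submodule.map_span, Submodule.map_top, Submodule.range_subtype, ← Set.image_comp] at this
    refine Eq.trans ?_ this
    simp only [Finset.coe_image, Set.coe_toFinset]
    rfl

lemma spanFinrank_maximalIdeal_quotient_add_one_le {R : Type*} [CommRing R] [IsLocalRing R]
    [IsNoetherianRing R] {x : R} (hx : x ∈ maximalIdeal R) (hx2 : x ∉ maximalIdeal R ^ 2)
    [IsLocalRing (R ⧸ Ideal.span {x})] :
    (maximalIdeal (R ⧸ Ideal.span {x})).spanFinrank + 1 ≤ (maximalIdeal R).spanFinrank := by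
  classical
  obtain ⟨s, hxs, hcard, hspan⟩ := exists_finset_span_maximalIdeal_of_notMem_sq hx hx2
  have h1 : maximalIdeal (R ⧸ Ideal.span {x}) =
      Ideal.span (((s.erase x).image (Ideal.Quotient.mk (Ideal.span {x})) : Finset _) : Set _) := by
    rw [← map_maximalIdeal_of_surjective (Ideal.Quotient.mk (Ideal.span {x}))
      Ideal.Quotient.mk_surjective, ← hspan, Ideal.map_span]
    apply le_antisymm
    · rw [Ideal.span_le]
      rintro _ ⟨y, hy, rfl⟩
      by_cases hyx : y = x
      · subst hyx
        rw [Ideal.Quotient.eq_zero_iff_mem.mpr (Ideal.mem_span_singleton_self y)]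
        exact Ideal.zero_mem _
      · apply Ideal.subset_span
        simp only [Finset.coe_image]
        exact ⟨y, by simpa [hyx] using hy, rfl⟩
    · apply Ideal.span_mono
      simp only [Finset.coe_image]
      exact Set.image_mono (by simp)
  rw [h1]
  have h2 := Submodule.spanFinrank_span_le_ncard_of_finite (R := R ⧸ Ideal.span {x})
    (Finset.finite_toSet ((s.erase x).image (Ideal.Quotient.mk (Ideal.span {x}))))
  rw [Set.ncard_coe_finset] at h2
  have h3 := Finset.card_image_le (s := s.erase x) (f := Ideal.Quotient.mk (Ideal.span {x}))
  have h4 := Finset.card_erase_add_one hxs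
  change Submodule.spanFinrank (Submodule.span _ _) + 1 ≤ _
  lia

lemma ringKrullDim_le_ringKrullDim_quotient_span_singleton_add_one {R : Type*} [CommRing R]
    [IsLocalRing R] [IsNoetherianRing R] {x : R} (hx : x ∈ maximalIdeal R) :
    ringKrullDim R ≤ ringKrullDim (R ⧸ Ideal.span {x}) + 1 := by
  have := ringKrullDim_le_ringKrullDim_quotient_add_encard {x} (by
    simpa [IsLocalRing.ringJacobson_eq_maximalIdeal] using hx)
  simpa using this

lemma IsRegularLocalRing.quotient_span_singleton {R : Type*} [CommRing R] [IsRegularLocalRing R]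
    {x : R} (hx : x ∈ maximalIdeal R) (hx2 : x ∉ maximalIdeal R ^ 2) :
    IsRegularLocalRing (R ⧸ Ideal.span {x}) := by
  have := isLocalRing_quotient_of_le (span_singleton_le_maximalIdeal hx)
  apply IsRegularLocalRing.of_spanFinrank_maximalIdeal_le
  have h1 := spanFinrank_maximalIdeal_quotient_add_one_le hx hx2
  have h2 := ringKrullDim_le_ringKrullDim_quotient_span_singleton_add_one hx
  rw [← (isRegularLocalRing_iff R).mp inferInstance] at h2
  have h3 : ((maximalIdeal (R ⧸ Ideal.span {x})).spanFinrank : WithBot ℕ∞) + 1 ≤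
      ringKrullDim (R ⧸ Ideal.span {x}) + 1 := h2.trans' (by exact_mod_cast h1)
  rwa [ENat.WithBot.add_le_add_one_right_iff] at h3

lemma IsRegularLocalRing.spanFinrank_quotient_add_one {R : Type*} [CommRing R]
    [IsRegularLocalRing R] {x : R} (hx : x ∈ maximalIdeal R) (hx2 : x ∉ maximalIdeal R ^ 2)
    [IsRegularLocalRing (R ⧸ Ideal.span {x})] :
    (maximalIdeal (R ⧸ Ideal.span {x})).spanFinrank + 1 = (maximalIdeal R).spanFinrank := by
  apply le_antisymm (spanFinrank_maximalIdeal_quotient_add_one_le hx hx2)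
  have h2 := ringKrullDim_le_ringKrullDim_quotient_span_singleton_add_one hx
  rw [← (isRegularLocalRing_iff R).mp inferInstance] at h2
  rw [← (isRegularLocalRing_iff (R ⧸ Ideal.span {x})).mp inferInstance] at h2
  exact_mod_cast h2

lemma isField_of_spanFinrank_maximalIdeal_eq_zero {R : Type*} [CommRing R] [IsLocalRing R]
    [IsNoetherianRing R] (h : (maximalIdeal R).spanFinrank = 0) : IsField R := by
  rw [isField_iff_maximalIdeal_eq]
  exact (Submodule.spanFinrank_eq_zero_iff_eq_bot (maximalIdeal R).fg_of_isNoetherianRing).mp h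

lemma IsRegularLocalRing.exists_notMem_sq {R : Type*} [CommRing R] [IsRegularLocalRing R]
    (h : (maximalIdeal R).spanFinrank ≠ 0) : ∃ x ∈ maximalIdeal R, x ∉ maximalIdeal R ^ 2 ∧
      ∀ p ∈ minimalPrimes R, x ∉ p := by
  by_contra! hc
  let s : Set (Ideal R) := insert (maximalIdeal R ^ 2) (minimalPrimes R)
  have hs : s.Finite := (minimalPrimes.finite_of_isNoetherianRing R).insert _
  have hsub : ((maximalIdeal R : Ideal R) : Set R) ⊆ ⋃ i ∈ s, ((id i : Ideal R) : Set R) := by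
    intro x hx
    by_cases h2 : x ∈ maximalIdeal R ^ 2
    · exact Set.mem_biUnion (Set.mem_insert _ _) h2
    · obtain ⟨p, hp, hxp⟩ := hc x hx h2
      exact Set.mem_biUnion (Set.mem_insert_of_mem _ hp) hxp
  obtain ⟨i, hi, hle⟩ := (Ideal.subset_union_prime_finite hs (f := id) (maximalIdeal R ^ 2)
    (maximalIdeal R ^ 2) (fun i hi h1 _ ↦ (hi.resolve_left h1).1.1)).mp hsub
  rcases hi with rfl | hi
  · apply h
    have := Submodule.eq_bot_of_le_smul_of_le_jacobson_bot (maximalIdeal R) (maximalIdeal R)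
      (maximalIdeal R).fg_of_isNoetherianRing (by simpa [pow_two] using hle)
      (by rw [IsLocalRing.jacobson_eq_maximalIdeal ⊥ bot_ne_top])
    rw [this, Submodule.spanFinrank_bot]
  · have hip : i.IsPrime := hi.1.1
    have hmi : maximalIdeal R = i := le_antisymm hle (le_maximalIdeal hip.ne_top)
    have h0 : (maximalIdeal R).height = 0 := Ideal.height_eq_zero_iff.mpr (hmi ▸ hi)
    have h1 := (isRegularLocalRing_iff R).mp inferInstance
    rw [← maximalIdeal_height_eq_ringKrullDim, h0] at h1
    exact h (by exact_mod_cast h1)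

lemma IsRegularLocalRing.isDomain (R : Type*) [CommRing R] [IsRegularLocalRing R] :
    IsDomain R := by
  generalize hd : (maximalIdeal R).spanFinrank = d
  induction d generalizing R with
  | zero => exact (isField_of_spanFinrank_maximalIdeal_eq_zero hd).isDomain
  | succ d ih =>
    obtain ⟨x, hx, hx2, hxp⟩ := IsRegularLocalRing.exists_notMem_sq (R := R) (by lia)
    have := IsRegularLocalRing.quotient_span_singleton hx hx2
    have hdom := ih (R ⧸ Ideal.span {x}) (by
      have := IsRegularLocalRing.spanFinrank_quotient_add_one hx hx2
      lia)
    have hprime : (Ideal.span {x}).IsPrime := (Ideal.Quotient.isDomain_iff_prime _).mp hdom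
    obtain ⟨p, hp, hpx⟩ := Ideal.exists_minimalPrimes_le (I := ⊥) (J := Ideal.span {x}) bot_le
    have hpp : p.IsPrime := hp.1.1
    have hbot : p = ⊥ := by
      apply Submodule.eq_bot_of_le_smul_of_le_jacobson_bot (Ideal.span {x}) p
        p.fg_of_isNoetherianRing
      · intro a ha
        obtain ⟨b, rfl⟩ := Ideal.mem_span_singleton'.mp (hpx ha)
        rw [mul_comm]
        exact Submodule.smul_mem_smul (Ideal.mem_span_singleton_self x)
          ((hpp.mem_or_mem ha).resolve_right (hxp p hp))
      · rw [IsLocalRing.jacobson_eq_maximalIdeal ⊥ bot_ne_top]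
        exact span_singleton_le_maximalIdeal hx
    subst hbot
    exact IsDomain.of_bot_isPrime R

/-- Serre: finitely generated modules over a regular local ring have finite projective dimension. -/
lemma IsRegularLocalRing.hasProjectiveDimensionLE (R : Type u) [CommRing R] [IsRegularLocalRing R]
    (d : ℕ) (hd : (maximalIdeal R).spanFinrank = d) (M : Type u) [AddCommGroup M] [Module R M]
    [Module.Finite R M] : HasProjectiveDimensionLE (ModuleCat.of R M) d := by
  induction d generalizing R M with
  | zero =>
    rw [hasProjectiveDimensionLE_zero_iff]
    let := (isField_of_spanFinrank_maximalIdeal_eq_zero hd).toField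
    exact Module.Projective.of_basis (Module.Basis.ofVectorSpace R M)
  | succ d ih =>
    obtain ⟨x, hx, hx2, -⟩ := IsRegularLocalRing.exists_notMem_sq (R := R) (by lia)
    have := IsRegularLocalRing.quotient_span_singleton hx hx2
    have hd' := IsRegularLocalRing.spanFinrank_quotient_add_one hx hx2
    have := IsRegularLocalRing.isDomain R
    have hreg : IsSMulRegular R x := by
      have hx0 : x ≠ 0 := fun h ↦ hx2 (h ▸ Ideal.zero_mem _)
      exact fun a b hab ↦ mul_left_cancel₀ hx0 hab
    obtain ⟨k, g, hg⟩ := Module.Finite.exists_fin' R M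
    have hP : IsSMulRegular (Fin k → R) x := fun a b hab ↦ by
      ext i
      exact hreg (congrFun hab i)
    rw [hasProjectiveDimensionLE_succ_iff (Submodule.injective_subtype _)
      (LinearMap.exact_subtype_ker_map g) hg]
    have : Module.Finite (R ⧸ Ideal.span {x}) (QuotSMulTop x (LinearMap.ker g)) :=
      Module.Finite.of_restrictScalars_finite R _ _
    exact hasProjectiveDimensionLE_of_quotSMulTop hreg hx d _ (hP.submodule _ _)
      (ih _ (by lia) _)

end RegularLocalRing

section FreeConormal

variable {B F : Type u} [CommRing B] [CommRing F] [Algebra B F]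

lemma exists_socle_of_isAssociatedPrime [IsNoetherianRing B] {P : Ideal B} [P.IsPrime]
    (hP : P ∈ associatedPrimes B B) :
    ∃ z : Localization.AtPrime P, z ≠ 0 ∧
      ∀ a ∈ maximalIdeal (Localization.AtPrime P), z * a = 0 := by
  rw [AssociatedPrimes.mem_iff, isAssociatedPrime_iff] at hP
  obtain ⟨-, y, hy⟩ := hP
  have hy' : ∀ a, a ∈ P ↔ a * y = 0 := fun a ↦ by
    rw [hy, Submodule.mem_colon_singleton]; simp
  refine ⟨algebraMap B _ y, fun h ↦ ?_, fun a ha ↦ ?_⟩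
  · obtain ⟨s, hs⟩ := (IsLocalization.map_eq_zero_iff P.primeCompl _ _).mp h
    exact s.2 ((hy' _).mpr hs)
  · obtain ⟨p, s, rfl⟩ := IsLocalization.exists_mk'_eq P.primeCompl a
    rw [IsLocalization.AtPrime.mk'_mem_maximal_iff (Localization.AtPrime P) P, hy'] at ha
    rw [IsLocalization.mul_mk'_eq_mk'_of_mul, mul_comm, ha, IsLocalization.mk'_zero]

/-- An ideal whose quotient has finite projective dimension and which surjects onto the quotient
is not contained in any associated prime. -/
lemma not_ker_le_of_mem_associatedPrimes [IsNoetherianRing B] [Nontrivial F]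
    (hsurj : Function.Surjective (algebraMap B F)) (k : ℕ)
    (hpd : HasProjectiveDimensionLE (ModuleCat.of B F) k)
    (φ : RingHom.ker (algebraMap B F) →ₗ[B] F) (hφ : Function.Surjective φ)
    {P : Ideal B} (hP : P ∈ associatedPrimes B B) : ¬ RingHom.ker (algebraMap B F) ≤ P := by
  intro hle
  have hPp : P.IsPrime := hP.isPrime
  obtain ⟨z, hz, hzm⟩ := exists_socle_of_isAssociatedPrime hP
  let N := (ModuleCat.of B F).localizedModule P.primeCompl
  let ℓ : F →ₗ[B] N := (ModuleCat.of B F).localizedModuleMkLinearMap P.primeCompl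
  have hloc : IsLocalizedModule P.primeCompl ℓ :=
    ModuleCat.localizedModule_isLocalizedModule (ModuleCat.of B F) P.primeCompl
  have hpdN : HasProjectiveDimensionLE N k :=
    ModuleCat.localizedModule_hasProjectiveDimensionLE k P.primeCompl (ModuleCat.of B F)
  have : Module.Finite B F := Module.Finite.of_surjective (Algebra.linearMap B F) hsurj
  have : Module.Finite (Localization.AtPrime P) N :=
    Module.Finite.of_isLocalizedModule P.primeCompl ℓ
  have hfree : Module.Free (Localization.AtPrime P) N :=
    free_of_hasProjectiveDimensionLE_of_socle hz hzm k N hpdN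
  have hs : ∀ s ∈ P.primeCompl, s • (1 : F) ≠ 0 := fun s hs h ↦ by
    refine hs (hle ?_)
    rwa [RingHom.mem_ker, Algebra.algebraMap_eq_smul_one]
  have : Nontrivial N := by
    refine ⟨ℓ 1, 0, fun h ↦ ?_⟩
    obtain ⟨s, hs1⟩ := (IsLocalizedModule.eq_zero_iff P.primeCompl ℓ).mp h
    exact hs _ s.2 hs1
  obtain ⟨x, hx⟩ := hφ 1
  have hx0 : algebraMap B (Localization.AtPrime P) x = 0 := by
    rw [← Submodule.mem_bot (R := Localization.AtPrime P),
      ← Module.annihilator_eq_bot.mpr (inferInstance : FaithfulSMul (Localization.AtPrime P) N),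
      Module.mem_annihilator]
    intro m
    obtain ⟨⟨m, s⟩, rfl⟩ := IsLocalizedModule.mk'_surjective P.primeCompl ℓ m
    rw [algebraMap_smul]
    change (x : B) • IsLocalizedModule.mk' ℓ m s = 0
    have hxm : (x : B) • m = 0 := by
      rw [Algebra.smul_def, RingHom.mem_ker.mp x.2, zero_mul]
    rw [← IsLocalizedModule.mk'_smul, hxm, IsLocalizedModule.mk'_zero]
  obtain ⟨s, hsx⟩ := (IsLocalization.map_eq_zero_iff P.primeCompl _ _).mp hx0
  apply hs s s.2
  rw [← hx, ← map_smul]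
  have : (s : B) • x = 0 := Subtype.ext hsx
  rw [this, map_zero]

lemma isSMulRegular_self_iff_forall_notMem [IsNoetherianRing B] {f : B} :
    IsSMulRegular B f ↔ ∀ P ∈ associatedPrimes B B, f ∉ P := by
  have h := Set.ext_iff.mp (biUnion_associatedPrimes_eq_compl_regular B B) f
  simp only [Set.mem_iUnion, SetLike.mem_coe, exists_prop, Set.mem_compl_iff,
    Set.mem_ofPred_eq] at h
  rw [← not_iff_not, ← h]
  push Not
  rfl

lemma exists_isSMulRegular_isUnit [IsNoetherianRing B] [IsLocalRing F]
    (hsurj : Function.Surjective (algebraMap B F)) (k : ℕ)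
    (hpd : HasProjectiveDimensionLE (ModuleCat.of B F) k) {n : ℕ}
    (φ : RingHom.ker (algebraMap B F) →ₗ[B] (Fin (n + 1) → F)) (hφ : Function.Surjective φ) :
    ∃ (f : RingHom.ker (algebraMap B F)) (i : Fin (n + 1)),
      IsUnit (φ f i) ∧ IsSMulRegular B (f : B) := by
  by_contra! hc
  let I := RingHom.ker (algebraMap B F)
  let I₀ : Ideal B := Submodule.map I.subtype (Submodule.comap φ
    (Submodule.pi Set.univ fun _ ↦ (maximalIdeal F).restrictScalars B))
  let s : Set (Ideal B) := insert I₀ (associatedPrimes B B)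
  have hs : s.Finite := (associatedPrimes.finite B B).insert _
  have hsub : (I : Set B) ⊆ ⋃ i ∈ s, ((id i : Ideal B) : Set B) := by
    intro x hx
    by_cases h2 : ∃ i, IsUnit (φ ⟨x, hx⟩ i)
    · obtain ⟨i, hi⟩ := h2
      have := hc ⟨x, hx⟩ i hi
      rw [isSMulRegular_self_iff_forall_notMem] at this
      push Not at this
      obtain ⟨P, hP, hxP⟩ := this
      exact Set.mem_biUnion (Set.mem_insert_of_mem _ hP) hxP
    · push Not at h2
      refine Set.mem_biUnion (Set.mem_insert _ _) ?_
      refine ⟨⟨x, hx⟩, ?_, rfl⟩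
      simpa [Submodule.mem_pi] using h2
  obtain ⟨P, hP, hle⟩ := (Ideal.subset_union_prime_finite hs (f := id) I₀ I₀
    (fun i hi h1 _ ↦ (hi.resolve_left h1).isPrime)).mp hsub
  rcases hP with rfl | hP
  · obtain ⟨x, hx⟩ := hφ (fun _ ↦ 1)
    obtain ⟨y, hy, hyx⟩ := hle x.2
    have : y = x := Subtype.ext hyx
    subst this
    have := (Submodule.mem_pi.mp hy) 0 trivial
    rw [hx] at this
    exact (Ideal.ne_top_iff_one _).mp (maximalIdeal.isMaximal F).ne_top this
  · refine not_ker_le_of_mem_associatedPrimes hsurj k hpd ((LinearMap.proj 0).comp φ) ?_ hP hle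
    exact (Function.surjective_eval 0).comp hφ

lemma hasProjectiveDimensionLE_ker (hsurj : Function.Surjective (algebraMap B F)) (k : ℕ)
    (hpd : HasProjectiveDimensionLE (ModuleCat.of B F) k) :
    HasProjectiveDimensionLE (ModuleCat.of B (RingHom.ker (algebraMap B F))) k := by
  rw [← hasProjectiveDimensionLE_succ_iff (f := (RingHom.ker (algebraMap B F)).subtype)
    (g := Algebra.linearMap B F) (Submodule.injective_subtype _) ?_ hsurj]
  · exact hasProjectiveDimensionLT_of_ge _ (k + 1) _ (by lia)
  · intro x
    simp [RingHom.mem_ker]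

/-- If `f ∈ I` is a nonzerodivisor and `λ : I → B / I` is linear with `λ f` a unit, then `B / I`
has finite projective dimension over `B / f`, being a retract of `I / f I`. -/
lemma hasProjectiveDimensionLE_of_isUnit (hsurj : Function.Surjective (algebraMap B F)) (k : ℕ)
    (hpd : HasProjectiveDimensionLE (ModuleCat.of B F) k)
    (lam : RingHom.ker (algebraMap B F) →ₗ[B] F) (f : RingHom.ker (algebraMap B F))
    (hf : IsUnit (lam f)) (hreg : IsSMulRegular B (f : B))
    [Algebra (B ⧸ Ideal.span {(f : B)}) F] [IsScalarTower B (B ⧸ Ideal.span {(f : B)}) F] :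
    HasProjectiveDimensionLE (ModuleCat.of (B ⧸ Ideal.span {(f : B)}) F) k := by
  obtain ⟨u, hu⟩ := hf
  have hfF : ∀ a ∈ RingHom.ker (algebraMap B F), ∀ y : F, a • y = 0 := fun a ha y ↦ by
    rw [Algebra.smul_def, RingHom.mem_ker.mp ha, zero_mul]
  let I := RingHom.ker (algebraMap B F)
  let r₀ : QuotSMulTop (f : B) I →ₗ[B] F :=
    Submodule.liftQ _ (LinearMap.mulLeft B (↑u⁻¹ : F) ∘ₗ lam) (by
      rintro _ ⟨y, -, rfl⟩
      rw [LinearMap.mem_ker]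
      change (LinearMap.mulLeft B (↑u⁻¹ : F) ∘ₗ lam) ((f : B) • y) = 0
      rw [map_smul, hfF _ f.2])
  let i₀ : F →ₗ[B] QuotSMulTop (f : B) I :=
    (Submodule.liftQ (LinearMap.ker (Algebra.linearMap B F))
      (LinearMap.toSpanSingleton B (QuotSMulTop (f : B) I) (Submodule.Quotient.mk f)) (by
        intro a ha
        rw [LinearMap.mem_ker, LinearMap.toSpanSingleton_apply, ← Submodule.Quotient.mk_smul,
          Submodule.Quotient.mk_eq_zero]
        refine (Submodule.mem_smul_pointwise_iff_exists _ _ _).mpr ⟨⟨a, ha⟩, trivial, ?_⟩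
        exact Subtype.ext (mul_comm _ _))).comp
    ((Algebra.linearMap B F).quotKerEquivOfSurjective hsurj).symm.toLinearMap
  have hri : r₀ ∘ₗ i₀ = LinearMap.id := by
    ext y
    obtain ⟨b, rfl⟩ := hsurj y
    have : ((Algebra.linearMap B F).quotKerEquivOfSurjective hsurj).symm (algebraMap B F b) =
        Submodule.Quotient.mk b := by
      rw [LinearEquiv.symm_apply_eq]; rfl
    simp only [LinearMap.comp_apply, LinearEquiv.coe_coe, this, i₀, LinearMap.id_apply]
    change r₀ (b • Submodule.Quotient.mk f) = _
    rw [map_smul]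
    change b • ((↑u⁻¹ : F) * lam f) = _
    rw [← hu, Units.inv_mul, Algebra.algebraMap_eq_smul_one]
  let i := i₀.extendScalarsOfSurjective (S := B ⧸ Ideal.span {(f : B)})
    Ideal.Quotient.mk_surjective
  let r := r₀.extendScalarsOfSurjective (S := B ⧸ Ideal.span {(f : B)})
    Ideal.Quotient.mk_surjective
  have ret : Retract (ModuleCat.of (B ⧸ Ideal.span {(f : B)}) F)
      (ModuleCat.of (B ⧸ Ideal.span {(f : B)}) (QuotSMulTop (f : B) I)) :=
    { i := ModuleCat.ofHom i
      r := ModuleCat.ofHom r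
      retract := by
        ext y
        exact LinearMap.congr_fun hri y }
  have := hasProjectiveDimensionLE_quotSMulTop hreg k I (hreg.submodule _ _)
    (hasProjectiveDimensionLE_ker hsurj k hpd)
  exact ret.hasProjectiveDimensionLT (k + 1)

lemma exists_socle_of_maximalIdeal_mem_associatedPrimes [IsNoetherianRing B] [IsLocalRing B]
    (h : maximalIdeal B ∈ associatedPrimes B B) :
    ∃ z : B, z ≠ 0 ∧ ∀ a ∈ maximalIdeal B, z * a = 0 := by
  rw [AssociatedPrimes.mem_iff, isAssociatedPrime_iff] at h
  obtain ⟨hm, y, hy⟩ := h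
  have hy' : ∀ a, a ∈ maximalIdeal B ↔ a * y = 0 := fun a ↦ by
    rw [hy, Submodule.mem_colon_singleton]; simp
  refine ⟨y, fun h ↦ ?_, fun a ha ↦ ?_⟩
  · exact (Ideal.ne_top_iff_one _).mp hm.ne_top ((hy' 1).mpr (by simp [h]))
  · rw [mul_comm]; exact (hy' a).mp ha

lemma exists_socle_of_krullDimLE_zero [IsNoetherianRing B] [IsLocalRing B]
    [Ring.KrullDimLE 0 B] : ∃ z : B, z ≠ 0 ∧ ∀ a ∈ maximalIdeal B, z * a = 0 := by
  obtain ⟨P, hP⟩ := associatedPrimes.nonempty B B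
  have hPp : P.IsPrime := hP.isPrime
  have : P.IsMaximal := hPp.isMaximal'
  exact exists_socle_of_maximalIdeal_mem_associatedPrimes (eq_maximalIdeal this ▸ hP)

lemma Ideal.exists_span_singleton_of_free [Nontrivial B] (I : Ideal B) [Module.Free B I]
    (hI : I ≠ ⊥) : ∃ a, IsSMulRegular B a ∧ Ideal.span {a} = I := by
  let b := Module.Free.chooseBasis B I
  have : Nontrivial I := Submodule.nontrivial_iff_ne_bot.mpr hI
  obtain ⟨i⟩ := b.index_nonempty
  have hsub : ∀ j, j = i := by
    intro j
    by_contra hij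
    have h1 : ((b j : I) : B) • b i = ((b i : I) : B) • b j := Subtype.ext (mul_comm _ _)
    have h2 := DFunLike.congr_fun (congrArg b.repr h1) i
    simp only [map_smul, Module.Basis.repr_self, Finsupp.smul_apply, Finsupp.single_eq_same,
      smul_eq_mul, mul_one] at h2
    rw [Finsupp.single_eq_of_ne (Ne.symm hij), mul_zero] at h2
    exact b.ne_zero j (Subtype.ext h2)
  refine ⟨b i, ?_, le_antisymm ?_ ?_⟩
  · intro x y hxy
    have h1 : x • b i = y • b i := Subtype.ext (by
      simpa [mul_comm] using hxy)
    have h2 := DFunLike.congr_fun (congrArg b.repr h1) i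
    simpa using h2
  · rw [Ideal.span_singleton_le_iff_mem]
    exact (b i).2
  · intro x hx
    have h1 : (⟨x, hx⟩ : I) = b.repr ⟨x, hx⟩ i • b i := by
      apply b.repr.injective
      ext j
      rw [hsub j]
      simp
    exact Ideal.mem_span_singleton'.mpr ⟨_, (congrArg Subtype.val h1).symm⟩

lemma ker_ne_bot_of_ringKrullDim (hsurj : Function.Surjective (algebraMap B F))
    (h : ringKrullDim B ≠ ringKrullDim F) : RingHom.ker (algebraMap B F) ≠ ⊥ := fun h0 ↦
  h (ringKrullDim_eq_of_ringEquiv (RingEquiv.ofBijective (algebraMap B F)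
    ⟨(RingHom.injective_iff_ker_eq_bot _).mpr h0, hsurj⟩))

lemma exists_span_singleton_eq_ker [IsNoetherianRing B] [IsLocalRing B] [Nontrivial F]
    (hsurj : Function.Surjective (algebraMap B F)) (k : ℕ)
    (hpd : HasProjectiveDimensionLE (ModuleCat.of B F) k)
    (hB : ringKrullDim B = 1) (hF : ringKrullDim F = 0) :
    ∃ a, IsSMulRegular B a ∧ Ideal.span {a} = RingHom.ker (algebraMap B F) := by
  have hbot := ker_ne_bot_of_ringKrullDim hsurj (by rw [hB, hF]; simp)
  by_cases hx : ∃ x ∈ maximalIdeal B, IsSMulRegular B x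
  · obtain ⟨x, hxm, hx⟩ := hx
    have := isLocalRing_quotient_of_le (span_singleton_le_maximalIdeal hxm)
    have hdim := ringKrullDim_quotient_span_singleton_succ_eq_ringKrullDim hx hxm
    have : Ring.KrullDimLE 0 (B ⧸ Ideal.span {x}) := by
      rw [Ring.krullDimLE_iff]
      rw [hB] at hdim
      rw [← ENat.WithBot.add_le_add_one_right_iff, hdim]
      simp
    obtain ⟨z, hz, hzm⟩ := exists_socle_of_krullDimLE_zero (B := B ⧸ Ideal.span {x})
    have : Module.Finite (B ⧸ Ideal.span {x}) (QuotSMulTop x (RingHom.ker (algebraMap B F))) :=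
      Module.Finite.of_restrictScalars_finite B _ _
    have hfree := free_of_hasProjectiveDimensionLE_of_socle hz hzm k _
      (hasProjectiveDimensionLE_quotSMulTop hx k _ (hx.submodule _ _)
        (hasProjectiveDimensionLE_ker hsurj k hpd))
    have := free_of_projective_quotSMulTop hxm _ (hx.submodule (RingHom.ker (algebraMap B F)) x)
      inferInstance
    exact Ideal.exists_span_singleton_of_free _ hbot
  · exfalso
    push Not at hx
    have hsub : (maximalIdeal B : Set B) ⊆
        ⋃ i ∈ associatedPrimes B B, ((id i : Ideal B) : Set B) := by
      intro x hxm
      have := hx x hxm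
      rw [isSMulRegular_self_iff_forall_notMem] at this
      push Not at this
      obtain ⟨P, hP, hxP⟩ := this
      exact Set.mem_biUnion hP hxP
    obtain ⟨P, hP, hle⟩ := (Ideal.subset_union_prime_finite (associatedPrimes.finite B B)
      (f := id) ⊥ ⊥ (fun i hi _ _ ↦ hi.isPrime)).mp hsub
    have hPm : maximalIdeal B = P := le_antisymm hle (le_maximalIdeal hP.isPrime.ne_top)
    obtain ⟨z, hz, hzm⟩ := exists_socle_of_maximalIdeal_mem_associatedPrimes (hPm ▸ hP)
    have : Module.Finite B F := Module.Finite.of_surjective (Algebra.linearMap B F) hsurj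
    have := free_of_hasProjectiveDimensionLE_of_socle hz hzm k F hpd
    apply hbot
    rw [eq_bot_iff, ← Module.annihilator_eq_bot.mpr (inferInstance : FaithfulSMul B F)]
    intro a ha
    rw [Module.mem_annihilator]
    intro y
    rw [Algebra.smul_def, RingHom.mem_ker.mp ha, zero_mul]

lemma isRegular_quotient_span_singleton_cons {f : B} (hreg : IsSMulRegular B f) (rs : List B)
    (hrs : IsRegular (B ⧸ Ideal.span {f}) (rs.map (Ideal.Quotient.mk (Ideal.span {f})))) :
    IsRegular B (f :: rs) := by
  rw [isRegular_cons_iff']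
  refine ⟨hreg, ?_⟩
  have e : (B ⧸ Ideal.span {f}) ≃ₗ[B] QuotSMulTop f B :=
    Submodule.quotEquivOfEq _ _ (by
      rw [← Submodule.ideal_span_singleton_smul, smul_eq_mul, Ideal.mul_top])
  exact ((e.extendScalarsOfSurjective (S := B ⧸ Ideal.span {f})
    Ideal.Quotient.mk_surjective).isRegular_congr _).mp hrs

lemma Ideal.ofList_cons_eq_of_map_mk_eq {f : B} {I : Ideal B} (hf : f ∈ I) (rs : List B)
    (h : Ideal.ofList (rs.map (Ideal.Quotient.mk (Ideal.span {f}))) =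
      I.map (Ideal.Quotient.mk (Ideal.span {f}))) : Ideal.ofList (f :: rs) = I := by
  rw [← Ideal.map_ofList] at h
  have := congrArg (Ideal.comap (Ideal.Quotient.mk (Ideal.span {f}))) h
  rw [Ideal.comap_map_of_surjective _ Ideal.Quotient.mk_surjective,
    Ideal.comap_map_of_surjective _ Ideal.Quotient.mk_surjective, ← RingHom.ker_eq_comap_bot,
    Ideal.mk_ker, sup_eq_left.mpr ((Ideal.span_singleton_le_iff_mem _).mpr hf)] at this
  rw [Ideal.ofList_cons, sup_comm, this]

/-- A surjection from an ideal `I` onto `(B / I)ⁿ⁺¹` which takes a unit value at `f` in some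
coordinate induces a surjection from the image of `I` in `B / f` onto `(B / I)ⁿ`. -/
lemma exists_surjective_ker_quotient_span_singleton {n : ℕ}
    (φ : RingHom.ker (algebraMap B F) →ₗ[B] (Fin (n + 1) → F)) (hφ : Function.Surjective φ)
    (f : RingHom.ker (algebraMap B F)) (i : Fin (n + 1)) (hf : IsUnit (φ f i))
    [Algebra (B ⧸ Ideal.span {(f : B)}) F] [IsScalarTower B (B ⧸ Ideal.span {(f : B)}) F] :
    ∃ φ' : RingHom.ker (algebraMap (B ⧸ Ideal.span {(f : B)}) F) →ₗ[B ⧸ Ideal.span {(f : B)}]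
      (Fin n → F), Function.Surjective φ' := by
  obtain ⟨u, hu⟩ := hf
  let B' := B ⧸ Ideal.span {(f : B)}
  let I := RingHom.ker (algebraMap B F)
  let I' := RingHom.ker (algebraMap B' F)
  have halg : ∀ b, algebraMap B' F (Ideal.Quotient.mk _ b) = algebraMap B F b := fun b ↦
    (IsScalarTower.algebraMap_apply B B' F b).symm
  let pr : (Fin (n + 1) → F) →ₗ[F] (Fin n → F) :=
    LinearMap.pi fun j ↦ LinearMap.proj (i.succAbove j) -
      (φ f (i.succAbove j) * (↑u⁻¹ : F)) • LinearMap.proj i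
  have hpr : Function.Surjective pr := fun v ↦ ⟨i.insertNth 0 v, by
    ext j
    simp [pr]⟩
  let ψ : I →ₗ[B] (Fin n → F) := (pr.restrictScalars B).comp φ
  have hψ : Function.Surjective ψ := hpr.comp hφ
  have hψf : ψ f = 0 := by
    ext j
    change φ f (i.succAbove j) - (φ f (i.succAbove j) * (↑u⁻¹ : F)) * φ f i = 0
    rw [← hu, mul_assoc, Units.inv_mul, mul_one, sub_self]
  let τ : I →ₗ[B] I' :=
    { toFun := fun a ↦ ⟨Ideal.Quotient.mk _ a, by
        rw [RingHom.mem_ker, halg]; exact a.2⟩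
      map_add' := fun _ _ ↦ Subtype.ext (map_add _ _ _)
      map_smul' := fun _ _ ↦ Subtype.ext (map_mul _ _ _) }
  have hτ : Function.Surjective τ := by
    rintro ⟨a, ha⟩
    obtain ⟨b, rfl⟩ := Ideal.Quotient.mk_surjective a
    rw [RingHom.mem_ker, halg] at ha
    exact ⟨⟨b, ha⟩, rfl⟩
  have hle : LinearMap.ker τ ≤ LinearMap.ker ψ := by
    intro a ha
    have h1 : Ideal.Quotient.mk (Ideal.span {(f : B)}) a = 0 :=
      congrArg Subtype.val (LinearMap.mem_ker.mp ha)
    obtain ⟨c, hc⟩ := Ideal.mem_span_singleton'.mp (Ideal.Quotient.eq_zero_iff_mem.mp h1)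
    have h2 : a = c • f := Subtype.ext hc.symm
    rw [LinearMap.mem_ker, h2, map_smul, hψf, smul_zero]
  let φ₀ : I' →ₗ[B] (Fin n → F) := ((LinearMap.ker τ).liftQ ψ hle).comp
    (τ.quotKerEquivOfSurjective hτ).symm.toLinearMap
  refine ⟨φ₀.extendScalarsOfSurjective (S := B') Ideal.Quotient.mk_surjective, fun v ↦ ?_⟩
  obtain ⟨a, rfl⟩ := hψ v
  refine ⟨τ a, ?_⟩
  change (LinearMap.ker τ).liftQ ψ hle ((τ.quotKerEquivOfSurjective hτ).symm (τ a)) = ψ a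
  have : (τ.quotKerEquivOfSurjective hτ).symm (τ a) = Submodule.Quotient.mk a := by
    rw [LinearEquiv.symm_apply_eq]; rfl
  rw [this, Submodule.liftQ_apply]

/-- A variant of a theorem of Vasconcelos: if `B / I` is zero-dimensional and of finite projective
dimension, and `I / I²` surjects onto `(B / I)ⁿ` with `dim B = n + 1`, then `I` is generated by a
regular sequence. -/
theorem exists_isRegular_ofList_eq_ker [IsLocalRing F] (hF : ringKrullDim F = 0) (n : ℕ) :
    ∀ (B : Type u) [CommRing B] [IsNoetherianRing B] [IsLocalRing B] [Algebra B F]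
      (_ : Function.Surjective (algebraMap B F)) (_ : ringKrullDim B = (n + 1 : ℕ)) (k : ℕ)
      (_ : HasProjectiveDimensionLE (ModuleCat.of B F) k)
      (φ : RingHom.ker (algebraMap B F) →ₗ[B] (Fin n → F)) (_ : Function.Surjective φ),
      ∃ rs : List B, IsRegular B rs ∧ Ideal.ofList rs = RingHom.ker (algebraMap B F) := by
  induction n with
  | zero =>
    intro B _ _ _ _ hsurj hB k hpd _ _
    obtain ⟨a, ha, hspan⟩ := exists_span_singleton_eq_ker hsurj k hpd (by simpa using hB) hF
    refine ⟨[a], isRegular_quotient_span_singleton_cons ha [] ?_, ?_⟩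
    · have : Nontrivial (B ⧸ Ideal.span {a}) := by
        rw [Ideal.Quotient.nontrivial_iff, hspan]
        exact RingHom.ker_ne_top _
      exact IsRegular.nil _ _
    · rw [Ideal.ofList_singleton, hspan]
  | succ n ih =>
    intro B _ _ _ _ hsurj hB k hpd φ hφ
    obtain ⟨f, i, hfi, hreg⟩ := exists_isSMulRegular_isUnit hsurj k hpd φ hφ
    let B' := B ⧸ Ideal.span {(f : B)}
    let : Algebra B' F := (Ideal.Quotient.lift (Ideal.span {(f : B)}) (algebraMap B F) (by
      intro a ha
      exact (Ideal.span_singleton_le_iff_mem _).mpr f.2 ha)).toAlgebra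
    have : IsScalarTower B B' F := IsScalarTower.of_algebraMap_eq fun _ ↦ rfl
    have hfm : (f : B) ∈ maximalIdeal B := le_maximalIdeal (RingHom.ker_ne_top _) f.2
    have := isLocalRing_quotient_of_le (span_singleton_le_maximalIdeal hfm)
    have hpd' := hasProjectiveDimensionLE_of_isUnit hsurj k hpd ((LinearMap.proj i).comp φ) f hfi
      hreg
    have hsurj' : Function.Surjective (algebraMap B' F) := fun y ↦ by
      obtain ⟨b, rfl⟩ := hsurj y
      exact ⟨Ideal.Quotient.mk _ b, rfl⟩
    obtain ⟨φ', hφ'⟩ := exists_surjective_ker_quotient_span_singleton φ hφ f i hfi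
    have hdim : ringKrullDim B' = (n + 1 : ℕ) := by
      have := ringKrullDim_quotient_span_singleton_succ_eq_ringKrullDim hreg hfm
      rw [hB, Nat.cast_add (n + 1) 1, Nat.cast_one] at this
      exact le_antisymm (ENat.WithBot.add_le_add_one_right_iff.mp this.le)
        (ENat.WithBot.add_le_add_one_right_iff.mp this.ge)
    obtain ⟨rs, hrs, hspan⟩ := ih B' hsurj' hdim k hpd' φ' hφ'
    obtain ⟨rs, rfl⟩ := (List.map_surjective_iff.mpr
      (Ideal.Quotient.mk_surjective (I := Ideal.span {(f : B)}))) rs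
    refine ⟨f :: rs, isRegular_quotient_span_singleton_cons hreg rs hrs,
      Ideal.ofList_cons_eq_of_map_mk_eq f.2 rs ?_⟩
    rw [hspan]
    refine le_antisymm (fun a ha ↦ ?_) (Ideal.map_le_iff_le_comap.mpr fun b hb ↦ hb)
    obtain ⟨b, rfl⟩ := Ideal.Quotient.mk_surjective a
    exact Ideal.mem_map_of_mem _ ha

end FreeConormal

section FlatLocal

open TensorProduct in
/-- For a flat local algebra `S` over a local ring `(R, m)`, the ideal `m S` surjects onto a free
`S / m S`-module of rank the embedding dimension of `R`. -/
lemma exists_surjective_map_maximalIdeal {R S : Type*} [CommRing R] [CommRing S] [IsLocalRing R]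
    [IsNoetherianRing R] [Algebra R S] [Module.Flat R S] :
    ∃ ψ : (maximalIdeal R).map (algebraMap R S) →ₗ[S]
      (Fin (maximalIdeal R).spanFinrank → S ⧸ (maximalIdeal R).map (algebraMap R S)),
      Function.Surjective ψ := by
  rw [spanFinrank_maximalIdeal_eq_finrank_cotangentSpace]
  set n := Module.finrank (ResidueField R) (CotangentSpace R)
  let m := maximalIdeal R
  let 𝔞 := m.map (algebraMap R S)
  let θ : S ⊗[R] m →ₗ[S] S := LinearMap.liftBaseChange S (Algebra.linearMap R S ∘ₗ m.subtype)
  have hθ : Function.Injective θ := by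
    have h1 := Module.Flat.iff_lTensor_injective'.mp (inferInstance : Module.Flat R S) m
    have h2 : ∀ x, θ x = TensorProduct.rid R S (m.subtype.lTensor S x) := by
      intro x
      induction x with
      | zero => simp
      | tmul s r => simp [θ, Algebra.smul_def, mul_comm]
      | add x y hx hy => simp only [map_add, hx, hy]
    intro x y hxy
    rw [h2, h2] at hxy
    exact h1 ((TensorProduct.rid R S).injective hxy)
  have hrange : LinearMap.range θ = 𝔞 := by
    apply le_antisymm
    · rintro _ ⟨x, rfl⟩
      induction x with
      | zero => simp
      | tmul s r => exact 𝔞.mul_mem_left s (Ideal.mem_map_of_mem _ r.2)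
      | add x y hx hy => rw [map_add]; exact add_mem hx hy
    · exact Ideal.map_le_iff_le_comap.mpr fun r hr ↦ ⟨1 ⊗ₜ ⟨r, hr⟩, by simp [θ]⟩
  let e : (S ⊗[R] m) ≃ₗ[S] 𝔞 :=
    (LinearEquiv.ofInjective θ hθ).trans (LinearEquiv.ofEq _ _ hrange)
  let κ : ResidueField R →ₐ[R] S ⧸ 𝔞 := Ideal.Quotient.liftₐ m (Algebra.ofId R (S ⧸ 𝔞)) (by
    intro a ha
    change Ideal.Quotient.mk 𝔞 (algebraMap R S a) = 0
    exact Ideal.Quotient.eq_zero_iff_mem.mpr (Ideal.mem_map_of_mem _ ha))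
  let b : Module.Basis (Fin n) (ResidueField R) (CotangentSpace R) :=
    Module.finBasis (ResidueField R) (CotangentSpace R)
  let g : m →ₗ[R] (Fin n → S ⧸ 𝔞) := LinearMap.pi fun j ↦
    κ.toLinearMap ∘ₗ (b.coord j).restrictScalars R ∘ₗ m.toCotangent
  let ξ : S ⊗[R] m →ₗ[S] (Fin n → S ⧸ 𝔞) := LinearMap.liftBaseChange S g
  have hξ : Function.Surjective ξ := by
    choose x hx using fun j ↦ m.toCotangent_surjective (b j)
    intro v
    choose s hs using fun j ↦ Ideal.Quotient.mk_surjective (v j)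
    refine ⟨∑ j, s j ⊗ₜ x j, ?_⟩
    have hg : ∀ j, g (x j) = Pi.single j 1 := by
      intro j
      ext i
      change κ (b.coord i (m.toCotangent (x j))) = _
      rw [hx, Module.Basis.coord_apply, Module.Basis.repr_self, Pi.single_apply,
        Finsupp.single_apply]
      by_cases hij : i = j
      · simp [hij]
      · simp [hij, Ne.symm hij]
    rw [map_sum]
    simp only [ξ, LinearMap.liftBaseChange_tmul, hg]
    ext i
    rw [Finset.sum_apply, Finset.sum_eq_single i]
    · simp [Algebra.smul_def, ← hs]
    · intro j _ hji
      simp [Ne.symm hji]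
    · simp
  exact ⟨ξ.comp e.symm.toLinearMap, hξ.comp e.symm.surjective⟩

/-- A surjection `𝔞 → (S / 𝔞)ⁿ` induces one from the kernel of `Q → S / 𝔞`, for any surjection
`Q → S / 𝔞²`. -/
lemma exists_surjective_ker_of_surjective_quotient_sq {S Q : Type*} [CommRing S] [CommRing Q]
    {𝔞 : Ideal S} {n : ℕ} (ψ : 𝔞 →ₗ[S] (Fin n → S ⧸ 𝔞)) (hψ : Function.Surjective ψ)
    (π : Q →+* S ⧸ 𝔞 ^ 2) (hπ : Function.Surjective π) [Algebra Q (S ⧸ 𝔞)]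
    (halg : algebraMap Q (S ⧸ 𝔞) =
      (Ideal.Quotient.factor (Ideal.pow_le_self two_ne_zero : 𝔞 ^ 2 ≤ 𝔞)).comp π) :
    ∃ φ : RingHom.ker (algebraMap Q (S ⧸ 𝔞)) →ₗ[Q] (Fin n → S ⧸ 𝔞),
      Function.Surjective φ := by
  have hψ0 : ∀ s : 𝔞, (s : S) ∈ 𝔞 ^ 2 → ψ s = 0 := by
    intro s hs
    have : s ∈ 𝔞 • (⊤ : Submodule S 𝔞) := by
      rw [Submodule.mem_smul_top_iff]
      simpa [pow_two] using hs
    induction this using Submodule.smul_induction_on' with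
    | smul r hr m hm =>
      rw [map_smul]
      ext j
      rw [Pi.smul_apply, Algebra.smul_def, Ideal.Quotient.algebraMap_eq,
        Ideal.Quotient.eq_zero_iff_mem.mpr hr, zero_mul, Pi.zero_apply]
    | add x hx y hy h1 h2 =>
      have hle : ∀ z ∈ 𝔞 • (⊤ : Submodule S 𝔞), (z : S) ∈ 𝔞 ^ 2 := fun z hz ↦ by
        rw [Submodule.mem_smul_top_iff] at hz
        simpa [pow_two] using hz
      rw [map_add, h1 (hle x hx), h2 (hle y hy), add_zero]
  have hfac : ∀ (s : S) (q : Q), Ideal.Quotient.mk (𝔞 ^ 2) s = π q →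
      algebraMap Q (S ⧸ 𝔞) q = Ideal.Quotient.mk 𝔞 s := by
    intro s q h
    rw [halg, RingHom.comp_apply, ← h]
    rfl
  choose σ hσ using fun q : Q ↦ Ideal.Quotient.mk_surjective (π q)
  have hmem : ∀ q : RingHom.ker (algebraMap Q (S ⧸ 𝔞)), σ q ∈ 𝔞 := fun q ↦ by
    rw [← Ideal.Quotient.eq_zero_iff_mem, ← hfac _ _ (hσ q)]
    exact q.2
  have key : ∀ (q : RingHom.ker (algebraMap Q (S ⧸ 𝔞))) (s : 𝔞),
      Ideal.Quotient.mk (𝔞 ^ 2) (s : S) = π q → ψ ⟨σ q, hmem q⟩ = ψ s := by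
    intro q s h
    rw [← sub_eq_zero, ← map_sub]
    apply hψ0
    exact Ideal.Quotient.eq.mp ((hσ q).trans h.symm)
  refine ⟨{ toFun := fun q ↦ ψ ⟨σ q, hmem q⟩, map_add' := fun p q ↦ ?_,
            map_smul' := fun p q ↦ ?_ }, fun v ↦ ?_⟩
  · rw [← map_add]
    apply key
    simp [hσ]
  · have : σ p • (⟨σ q, hmem q⟩ : 𝔞) = ⟨σ p * σ q, 𝔞.mul_mem_left _ (hmem q)⟩ := rfl
    rw [key (p • q) (σ p • ⟨σ q, hmem q⟩) (by simp [hσ]), map_smul]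
    ext j
    simp only [Pi.smul_apply, RingHom.id_apply]
    rw [Algebra.smul_def, Algebra.smul_def, hfac _ _ (hσ p)]
    rfl
  · obtain ⟨s, rfl⟩ := hψ v
    obtain ⟨q, hq⟩ := hπ (Ideal.Quotient.mk _ s)
    refine ⟨⟨q, ?_⟩, key ⟨q, _⟩ s hq.symm⟩
    rw [RingHom.mem_ker, hfac s q hq.symm]
    exact Ideal.Quotient.eq_zero_iff_mem.mpr s.2

lemma ringKrullDim_fiber_eq_zero {R S : Type*} [CommRing R] [CommRing S] [IsLocalRing R]
    [IsLocalRing S] [IsNoetherianRing R] [IsNoetherianRing S] [Algebra R S] [Module.Flat R S]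
    [IsLocalHom (algebraMap R S)] (h : ringKrullDim R = ringKrullDim S)
    [IsLocalRing (S ⧸ (maximalIdeal R).map (algebraMap R S))] :
    ringKrullDim (S ⧸ (maximalIdeal R).map (algebraMap R S)) = 0 := by
  have h1 := Ideal.height_eq_height_add_of_liesOver_of_hasGoingDown
    (maximalIdeal R) (maximalIdeal S)
  rw [map_maximalIdeal_of_surjective _ Ideal.Quotient.mk_surjective] at h1
  rw [← maximalIdeal_height_eq_ringKrullDim, ← maximalIdeal_height_eq_ringKrullDim] at h
  rw [← maximalIdeal_height_eq_ringKrullDim]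
  have h2 : (maximalIdeal R).height ≠ ⊤ := Ideal.height_ne_top_of_isPrime
  have h3 : (maximalIdeal R).height = (maximalIdeal S).height := by exact_mod_cast h
  rw [← h3] at h1
  have : (maximalIdeal (S ⧸ (maximalIdeal R).map (algebraMap R S))).height = 0 := by
    apply ENat.add_right_injective_of_ne_top h2
    simpa using h1.symm
  rw [this]
  rfl

end FlatLocal

section FormallySmooth

lemma Algebra.Generators.cotangentComplex_injective_iff {R S ι : Type*} [CommRing R] [CommRing S]
    [Algebra R S] (P : Algebra.Generators R S ι) :
    Function.Injective P.toExtension.cotangentComplex ↔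
      ∀ f : MvPolynomial ι R, MvPolynomial.aeval P.val f = 0 →
        (∀ i, MvPolynomial.aeval P.val (MvPolynomial.pderiv i f) = 0) →
        f ∈ RingHom.ker (MvPolynomial.aeval (R := R) P.val) ^ 2 := by
  have hker : P.toExtension.ker = RingHom.ker (MvPolynomial.aeval (R := R) P.val) :=
    P.ker_eq_ker_aeval_val
  have hz : ∀ x : P.toExtension.ker, P.toExtension.cotangentComplex (.mk x) = 0 ↔
      ∀ i, MvPolynomial.aeval P.val (MvPolynomial.pderiv i (x.1 : MvPolynomial ι R)) = 0 := by
    intro x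
    rw [Algebra.Extension.cotangentComplex_mk, ← P.cotangentSpaceBasis.repr.map_eq_zero_iff,
      Finsupp.ext_iff]
    refine forall_congr' fun i ↦ ?_
    rw [Algebra.Generators.cotangentSpaceBasis_repr_one_tmul]
    rfl
  rw [injective_iff_map_eq_zero]
  constructor
  · intro H f hf hd
    have hf' : f ∈ P.toExtension.ker := by rw [hker]; exact hf
    have := H (.mk ⟨f, hf'⟩) ((hz _).mpr hd)
    rw [← hker]
    exact (Algebra.Extension.Cotangent.mk_eq_zero_iff _).mp this
  · intro H x hx
    obtain ⟨x, rfl⟩ := Algebra.Extension.Cotangent.mk_surjective x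
    rw [Algebra.Extension.Cotangent.mk_eq_zero_iff]
    have h1 := x.2
    have h2 := H x.1
    rw [← hker] at h2
    exact h2 (hker.le h1) ((hz _).mp hx)

/-- Any field extension of a perfect field is formally smooth. -/
theorem formallySmooth_of_perfectField (K L : Type*) [Field K] [Field L] [Algebra K L]
    [PerfectField K] : Algebra.FormallySmooth K L := by
  refine (Algebra.formallySmooth_iff K L).mpr ⟨inferInstance, ?_⟩
  have hsm : Algebra.FormallySmooth K (Algebra.Generators.self K L).toExtension.Ring :=
    inferInstanceAs (Algebra.FormallySmooth K (MvPolynomial L K))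
  rw [← (Algebra.Generators.self K L).toExtension.cotangentComplex_injective_iff,
    Algebra.Generators.cotangentComplex_injective_iff]
  intro f hf hd
  change MvPolynomial.aeval (id : L → L) f = 0 at hf
  change ∀ i, MvPolynomial.aeval (id : L → L) _ = 0 at hd
  change f ∈ RingHom.ker (MvPolynomial.aeval (R := K) (id : L → L)) ^ 2
  let E := IntermediateField.adjoin K (f.vars : Set L)
  have : Algebra.EssFiniteType K E := by
    rw [IntermediateField.essFiniteType_iff]
    exact IntermediateField.fg_adjoin_finset _
  have hE : Algebra.FormallySmooth K E := inferInstance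
  have hsmE : Algebra.FormallySmooth K (Algebra.Generators.self K E).toExtension.Ring :=
    inferInstanceAs (Algebra.FormallySmooth K (MvPolynomial E K))
  have hE := ((Algebra.formallySmooth_iff K E).mp hE).2
  rw [← (Algebra.Generators.self K E).toExtension.cotangentComplex_injective_iff,
    Algebra.Generators.cotangentComplex_injective_iff] at hE
  have hcomm : ∀ g : MvPolynomial E K,
      MvPolynomial.aeval (id : L → L) (MvPolynomial.rename Subtype.val g) =
      algebraMap E L (MvPolynomial.aeval (id : E → E) g) := by
    intro g
    rw [MvPolynomial.aeval_rename, ← MvPolynomial.aeval_algebraMap_apply]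
    rfl
  have hfE : f ∈ MvPolynomial.supported K (E : Set L) :=
    MvPolynomial.mem_supported.mpr (IntermediateField.subset_adjoin K _)
  rw [MvPolynomial.supported_eq_range_rename] at hfE
  obtain ⟨g, hgf⟩ : ∃ g : MvPolynomial E K, MvPolynomial.rename Subtype.val g = f := hfE
  rw [← hgf] at hf hd ⊢
  have hg := hE g ((algebraMap E L).injective (by rw [map_zero, ← hf, hcomm]; rfl))
    (fun i ↦ (algebraMap E L).injective (by
      rw [map_zero, ← hd i, MvPolynomial.pderiv_rename Subtype.val_injective, hcomm]; rfl))
  have := Ideal.mem_map_of_mem (MvPolynomial.rename (R := K) (Subtype.val : E → L)) hg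
  rw [Ideal.map_pow] at this
  refine Ideal.pow_right_mono ?_ 2 this
  rw [Ideal.map_le_iff_le_comap]
  intro x hx
  have hx : MvPolynomial.aeval (id : E → E) x = 0 := hx
  change MvPolynomial.aeval (id : L → L) (MvPolynomial.rename Subtype.val x) = 0
  rw [hcomm, hx, map_zero]

end FormallySmooth

section CohenRing

/-- A pair of homomorphisms `i : A → K` and `q : A → l` such that `q` factors through the image
of `i`, and every nonzero element of this image is, up to a power of `p`, the image of an element
that survives in `l`. -/
def IsUnramifiedPair {A K l : Type*} [CommRing A] [CommRing K] [CommRing l] (p : ℕ)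
    (i : A →+* K) (q : A →+* l) : Prop :=
  (∀ a, i a = 0 → q a = 0) ∧ ∀ a, i a ≠ 0 → ∃ (n : ℕ) (b : A), q b ≠ 0 ∧ i a = p ^ n * i b

variable {p : ℕ} {K l : Type*} [Field K] [Field l]

lemma IsUnramifiedPair.range {A : Type*} [CommRing A] {i : A →+* K} {q : A →+* l}
    (h : IsUnramifiedPair p i q) :
    IsUnramifiedPair p ((RingHom.fst K l).comp (i.prod q).range.subtype)
      ((RingHom.snd K l).comp (i.prod q).range.subtype) := by
  refine ⟨?_, ?_⟩
  · rintro ⟨_, a, rfl⟩ ha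
    exact h.1 a ha
  · rintro ⟨_, a, rfl⟩ ha
    obtain ⟨n, b, hb, hab⟩ := h.2 a ha
    exact ⟨n, ⟨_, b, rfl⟩, hb, hab⟩

/-- The localization of a subring of `K × l` at the elements with nonzero second component. -/
def Subring.localizationSnd (Γ : Subring (K × l)) : Subring (K × l) where
  carrier := {x | ∃ a ∈ Γ, ∃ b ∈ Γ, b.2 ≠ 0 ∧ a = x * b}
  mul_mem' := by
    rintro x y ⟨a, ha, b, hb, hb0, h⟩ ⟨a', ha', b', hb', hb0', h'⟩
    exact ⟨a * a', mul_mem ha ha', b * b', mul_mem hb hb', mul_ne_zero hb0 hb0', by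
      rw [h, h']; ring⟩
  one_mem' := ⟨1, one_mem _, 1, one_mem _, one_ne_zero, by simp⟩
  add_mem' := by
    rintro x y ⟨a, ha, b, hb, hb0, h⟩ ⟨a', ha', b', hb', hb0', h'⟩
    exact ⟨a * b' + a' * b, add_mem (mul_mem ha hb') (mul_mem ha' hb), b * b', mul_mem hb hb',
      mul_ne_zero hb0 hb0', by rw [h, h']; ring⟩
  zero_mem' := ⟨0, zero_mem _, 1, one_mem _, one_ne_zero, by simp⟩
  neg_mem' := by
    rintro x ⟨a, ha, b, hb, hb0, h⟩
    exact ⟨-a, neg_mem ha, b, hb, hb0, by rw [h]; ring⟩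

lemma Subring.le_localizationSnd (Γ : Subring (K × l)) : Γ ≤ Γ.localizationSnd :=
  fun a ha ↦ ⟨a, ha, 1, one_mem _, one_ne_zero, by simp⟩

/-- The condition that the two projections of a subring of `K × l` form an unramified pair. -/
def Subring.IsUnramified (p : ℕ) (Γ : Subring (K × l)) : Prop :=
  IsUnramifiedPair p ((RingHom.fst K l).comp Γ.subtype) ((RingHom.snd K l).comp Γ.subtype)

lemma Subring.IsUnramified.fst_ne_zero {Γ : Subring (K × l)} (h : Γ.IsUnramified p) {x : K × l}
    (hx : x ∈ Γ) (hx2 : x.2 ≠ 0) : x.1 ≠ 0 :=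
  fun h0 ↦ hx2 (h.1 ⟨x, hx⟩ h0)

lemma Subring.IsUnramified.localizationSnd {Γ : Subring (K × l)} (h : Γ.IsUnramified p) :
    Γ.localizationSnd.IsUnramified p := by
  refine ⟨?_, ?_⟩
  · rintro ⟨x, a, ha, b, hb, hb0, hab⟩ (hx : x.1 = 0)
    have h1 : a.2 = 0 := h.1 ⟨a, ha⟩ (by change a.1 = 0; rw [hab, Prod.fst_mul, hx, zero_mul])
    rw [hab, Prod.snd_mul] at h1
    exact (mul_eq_zero.mp h1).resolve_right hb0
  · rintro ⟨x, a, ha, b, hb, hb0, hab⟩ (hx : x.1 ≠ 0)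
    have hb1 := h.fst_ne_zero hb hb0
    obtain ⟨n, ⟨e, he⟩, he0, hae⟩ := h.2 ⟨a, ha⟩ (by
      change a.1 ≠ 0; rw [hab, Prod.fst_mul]; exact mul_ne_zero hx hb1)
    replace he0 : e.2 ≠ 0 := he0
    replace hae : a.1 = p ^ n * e.1 := hae
    refine ⟨n, ⟨(e.1 / b.1, e.2 / b.2), e, he, b, hb, hb0, ?_⟩, div_ne_zero he0 hb0, ?_⟩
    · ext <;> simp [hb1, hb0]
    · change x.1 = p ^ n * (e.1 / b.1)
      rw [← mul_div_assoc, ← hae, hab, Prod.fst_mul, mul_div_cancel_right₀ _ hb1]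

lemma Subring.IsUnramified.inv_mem {Γ : Subring (K × l)}
    (h : Maximal (Subring.IsUnramified p) Γ) {x : K × l} (hx : x ∈ Γ) (hx2 : x.2 ≠ 0) :
    x⁻¹ ∈ Γ := by
  rw [h.eq_of_le h.1.localizationSnd Γ.le_localizationSnd]
  have hx1 := h.1.fst_ne_zero hx hx2
  exact ⟨1, one_mem _, x, hx, hx2, by ext <;> simp [hx1, hx2]⟩

section Pair

variable {W : Type*} [CommRing W] {i : W →+* K} {q : W →+* l}

lemma IsUnramifiedPair.ker_eq_span [CharZero K] [CharP l p] (h : IsUnramifiedPair p i q)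
    (hi : Function.Injective i) : RingHom.ker q = Ideal.span {(p : W)} := by
  apply le_antisymm
  · intro a ha
    rw [Ideal.mem_span_singleton]
    by_cases h0 : i a = 0
    · rw [hi (h0.trans (map_zero i).symm)]
      exact dvd_zero _
    · obtain ⟨n, b, hb, hab⟩ := h.2 a h0
      have : a = p ^ n * b := hi (by simpa using hab)
      rcases n with _ | n
      · rw [pow_zero, one_mul] at this
        exact absurd (this ▸ ha) hb
      · exact ⟨p ^ n * b, by rw [this, pow_succ]; ring⟩
  · rw [Ideal.span_singleton_le_iff_mem, RingHom.mem_ker, map_natCast, CharP.cast_eq_zero]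

lemma IsUnramifiedPair.isDiscreteValuationRing [CharZero K] [CharP l p] [Fact p.Prime]
    (h : IsUnramifiedPair p i q) (hi : Function.Injective i) (hu : ∀ w, q w ≠ 0 → IsUnit w)
    [IsDomain W] : IsDiscreteValuationRing W := by
  have hp0 : (p : W) ≠ 0 := by
    intro h0
    have := congr_arg i h0
    rw [map_natCast, map_zero, Nat.cast_eq_zero] at this
    exact (Fact.out : p.Prime).ne_zero this
  have hker := h.ker_eq_span hi
  have hpu : ¬ IsUnit (p : W) := fun hpu ↦ by
    have := hpu.map q
    rw [map_natCast, CharP.cast_eq_zero] at this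
    exact not_isUnit_zero this
  have hdvd : ∀ a : W, ¬ IsUnit a → (p : W) ∣ a := fun a ha ↦ by
    rw [← Ideal.mem_span_singleton, ← hker, RingHom.mem_ker]
    exact not_not.mp (mt (hu a) ha)
  refine IsDiscreteValuationRing.ofHasUnitMulPowIrreducibleFactorization
    ⟨p, ⟨hpu, fun a b hab ↦ ?_⟩, fun {a} ha ↦ ?_⟩
  · by_contra! hc
    obtain ⟨c, rfl⟩ := hdvd a hc.1
    obtain ⟨d, rfl⟩ := hdvd b hc.2
    refine hpu (IsUnit.of_mul_eq_one (c * d) (mul_left_cancel₀ hp0 ?_))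
    rw [mul_one]
    nth_rw 3 [hab]
    ring
  · obtain ⟨n, b, hb, hab⟩ := h.2 a (fun h0 ↦ ha (hi (h0.trans (map_zero i).symm)))
    obtain ⟨u, rfl⟩ := hu b hb
    exact ⟨n, u, hi (by simpa using hab.symm)⟩

open Polynomial

lemma IsUnramifiedPair.exists_polynomial_eq_pow_mul [CharZero K] [CharP l p] [Fact p.Prime]
    [IsDomain W] (h : IsUnramifiedPair p i q) (hi : Function.Injective i) {G : W[X]} (hG : G ≠ 0) :
    ∃ (n : ℕ) (H : W[X]), H.map q ≠ 0 ∧ G = C (p : W) ^ n * H := by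
  have hker := h.ker_eq_span hi
  have hmap : ∀ H : W[X], H.map q = 0 ↔ C (p : W) ∣ H := by
    intro H
    rw [C_dvd_iff_dvd_coeff, Polynomial.ext_iff]
    refine forall_congr' fun j ↦ ?_
    rw [coeff_map, coeff_zero, ← RingHom.mem_ker, hker, Ideal.mem_span_singleton]
  have hfin : FiniteMultiplicity (C (p : W)) G := by
    obtain ⟨j, hj⟩ : ∃ j, G.coeff j ≠ 0 := by
      by_contra! hc
      exact hG (Polynomial.ext (by simpa using hc))
    obtain ⟨n, b, hb, hab⟩ := h.2 (G.coeff j) (fun h0 ↦ hj (hi (h0.trans (map_zero i).symm)))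
    have hab : G.coeff j = p ^ n * b := hi (by simpa using hab)
    refine ⟨n, fun hd ↦ hb ?_⟩
    rw [← C_pow, C_dvd_iff_dvd_coeff] at hd
    obtain ⟨c, hc⟩ := hd j
    have hp0 : (p : W) ^ n ≠ 0 := fun h0 ↦ hj (by rw [hab, h0, zero_mul])
    rw [hab, pow_succ, mul_assoc] at hc
    rw [mul_left_cancel₀ hp0 hc, map_mul, map_natCast, CharP.cast_eq_zero, zero_mul]
  obtain ⟨H, hH, hnd⟩ := hfin.exists_eq_pow_mul_and_not_dvd
  exact ⟨_, H, by rwa [Ne, hmap], hH⟩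

/-- An unramified pair extends to the ring generated by an element of `l` that is algebraic over
the image. -/
lemma IsUnramifiedPair.exists_eval₂RingHom [CharZero K] [CharP l p] [Fact p.Prime] [IsAlgClosed K]
    [IsDomain W] [IsIntegrallyClosed W]
    (h : IsUnramifiedPair p i q) (hi : Function.Injective i) (hu : ∀ w, q w ≠ 0 → IsUnit w)
    {α : l} {G : W[X]} (hG : G.map q ≠ 0) (hGα : G.eval₂ q α = 0) :
    ∃ θ : K, IsUnramifiedPair p (eval₂RingHom i θ) (eval₂RingHom q α) := by
  have hmonic : ∀ G : W[X], G.map q ≠ 0 → G.eval₂ q α = 0 →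
      ∃ F : W[X], F.Monic ∧ F.eval₂ q α = 0 ∧ F.natDegree ≤ G.natDegree := by
    intro G hG hGα
    have hlc : (G.map q).leadingCoeff ≠ 0 := leadingCoeff_ne_zero.mpr hG
    have hu' : IsUnit (G.coeff (G.map q).natDegree) :=
      hu _ (by rwa [leadingCoeff, coeff_map] at hlc)
    obtain ⟨u, hu'⟩ := hu'
    have hinv : q (u⁻¹ : Wˣ) * (G.map q).leadingCoeff = 1 := by
      rw [leadingCoeff, coeff_map, ← hu', ← map_mul, Units.inv_mul, map_one]
    have hm : (C (q (u⁻¹ : Wˣ)) * G.map q).Monic := by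
      rw [Monic, leadingCoeff_mul, leadingCoeff_C, hinv]
    obtain ⟨F, hF, hFd, hFm⟩ := lifts_and_natDegree_eq_and_monic (f := q)
      ((mem_lifts _).mpr ⟨C ((u⁻¹ : Wˣ) : W) * G, by simp⟩) hm
    refine ⟨F, hFm, ?_, ?_⟩
    · rw [eval₂_eq_eval_map, hF, eval_mul, ← eval₂_eq_eval_map, hGα, mul_zero]
    · rw [hFd]
      exact (natDegree_C_mul_le _ _).trans (natDegree_map_le)
  classical
  let P : ℕ → Prop := fun n ↦ ∃ F : W[X], F.Monic ∧ F.eval₂ q α = 0 ∧ F.natDegree = n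
  have hP : ∃ n, P n := by
    obtain ⟨F, h1, h2, -⟩ := hmonic G hG hGα
    exact ⟨_, F, h1, h2, rfl⟩
  obtain ⟨F, hFm, hFα, hFn⟩ := Nat.find_spec hP
  have hmin : ∀ H : W[X], H.eval₂ q α = 0 → H.natDegree < F.natDegree → H.map q = 0 := by
    intro H hHα hd
    by_contra h0
    obtain ⟨F', h1, h2, h3⟩ := hmonic H h0 hHα
    exact Nat.find_min hP (hFn ▸ h3.trans_lt hd) ⟨F', h1, h2, rfl⟩
  have hFdeg : F.natDegree ≠ 0 := by
    intro h0
    rw [hFm.natDegree_eq_zero.mp h0, eval₂_one] at hFα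
    exact one_ne_zero hFα
  obtain ⟨θ, hθ⟩ := IsAlgClosed.exists_eval₂_eq_zero_of_injective i hi F (by
    rwa [Ne, degree_eq_natDegree hFm.ne_zero, Nat.cast_eq_zero])
  let := i.toAlgebra
  have : FaithfulSMul W K := (faithfulSMul_iff_algebraMap_injective W K).mpr hi
  have : Module.IsTorsionFree W K := .trans_faithfulSMul W K K
  have hint : IsIntegral W θ := ⟨F, hFm, hθ⟩
  have hMα : (minpoly W θ).eval₂ q α = 0 := by
    obtain ⟨H, hH⟩ := minpoly.isIntegrallyClosed_dvd hint hθ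
    have hMm := minpoly.monic hint
    have hHm : H.Monic := hMm.of_mul_monic_left (hH ▸ hFm)
    have hprod := hFα
    rw [hH, eval₂_mul] at hprod
    refine (mul_eq_zero.mp hprod).resolve_right fun hH0 ↦ ?_
    have h1 := hMm.natDegree_mul hHm
    rw [← hH] at h1
    have h2 := minpoly.natDegree_pos hint
    have h3 := hmin H hH0 (by omega)
    exact (hHm.map q).ne_zero h3
  have hmod : ∀ G : W[X], eval₂RingHom i θ (G %ₘ F) = eval₂RingHom i θ G := by
    intro G
    conv_rhs => rw [← modByMonic_add_div G F, map_add, map_mul]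
    rw [coe_eval₂RingHom, hθ, zero_mul, add_zero]
  refine ⟨θ, fun G hG0 ↦ ?_, fun G hG0 ↦ ?_⟩
  · obtain ⟨H, rfl⟩ := minpoly.isIntegrallyClosed_dvd hint (p := G) hG0
    rw [map_mul, coe_eval₂RingHom, hMα, zero_mul]
  · have hne : G %ₘ F ≠ 0 := fun h0 ↦ hG0 (by rw [← hmod, h0, map_zero])
    obtain ⟨n, H, hH, hGH⟩ := h.exists_polynomial_eq_pow_mul hi hne
    refine ⟨n, H, fun hHα ↦ hH (hmin H hHα ?_), ?_⟩
    · have hd := natDegree_modByMonic_lt G hFm (by rintro rfl; simp at hFdeg)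
      have hp0 : C (p : W) ^ n ≠ 0 := fun h0 ↦ hne (by rw [hGH, h0, zero_mul])
      rwa [hGH, ← C_pow, natDegree_C_mul (by rwa [← C_pow, Ne, C_eq_zero] at hp0)] at hd
    · rw [← hmod, hGH, map_mul, map_pow]
      simp

end Pair

lemma Subring.IsUnramified.of_isChain {c : Set (Subring (K × l))}
    (hc : ∀ Γ ∈ c, Γ.IsUnramified p) (hchain : IsChain (· ≤ ·) c) (hne : c.Nonempty) :
    (sSup c).IsUnramified p := by
  have hmem : ∀ {x}, x ∈ sSup c ↔ ∃ Γ ∈ c, x ∈ Γ :=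
    Subring.mem_sSup_of_directedOn hne hchain.directedOn
  refine ⟨?_, ?_⟩
  · rintro ⟨x, hx⟩ h0
    obtain ⟨Γ, hΓ, hxΓ⟩ := hmem.mp hx
    exact (hc Γ hΓ).1 ⟨x, hxΓ⟩ h0
  · rintro ⟨x, hx⟩ h0
    obtain ⟨Γ, hΓ, hxΓ⟩ := hmem.mp hx
    obtain ⟨n, ⟨b, hb⟩, hb0, hab⟩ := (hc Γ hΓ).2 ⟨x, hxΓ⟩ h0
    exact ⟨n, ⟨b, hmem.mpr ⟨Γ, hΓ, hb⟩⟩, hb0, hab⟩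

lemma isUnramifiedPair_mvPolynomial_int [Fact p.Prime] [Algebra (ZMod p) l] {ι : Type*}
    {x : ι → l} (hx : AlgebraicIndependent (ZMod p) x) {i : MvPolynomial ι ℤ →+* K}
    (hi : Function.Injective i) :
    IsUnramifiedPair p i (MvPolynomial.eval₂Hom (Int.castRingHom l) x) := by
  refine ⟨fun a ha ↦ ?_, fun a ha ↦ ?_⟩
  · rw [hi (ha.trans (map_zero i).symm), map_zero]
  · have ha0 : a ≠ 0 := by rintro rfl; exact ha (map_zero i)
    have hp : ¬ IsUnit (MvPolynomial.C (p : ℤ) : MvPolynomial ι ℤ) := fun hu ↦ by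
      have := hu.map (MvPolynomial.eval (0 : ι → ℤ))
      rw [MvPolynomial.eval_C] at this
      exact (Nat.prime_iff_prime_int.mp Fact.out).not_isUnit this
    obtain ⟨b, hb, hnd⟩ :=
      (FiniteMultiplicity.of_not_isUnit hp ha0).exists_eq_pow_mul_and_not_dvd
    refine ⟨multiplicity (MvPolynomial.C (p : ℤ)) a, b, ?_, ?_⟩
    · rw [MvPolynomial.C_dvd_iff_map_hom_eq_zero (Int.castRingHom (ZMod p)) p
        (fun r ↦ ZMod.intCast_zmod_eq_zero_iff_dvd r p)] at hnd
      intro h0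
      refine hnd ((injective_iff_map_eq_zero _).mp hx _ ?_)
      rw [MvPolynomial.aeval_def, MvPolynomial.eval₂_map]
      rw [← h0, MvPolynomial.coe_eval₂Hom]
      congr 1
      exact RingHom.ext_int _ _
    · nth_rw 1 [hb]
      simp

/-- Cohen rings exist: every field of characteristic `p` is the residue field of a discrete
valuation ring of characteristic zero with uniformizer `p`. -/
theorem exists_cohenRing (p : ℕ) [Fact p.Prime] (l : Type u) [Field l] [CharP l p] :
    ∃ (W : Type u) (_ : CommRing W) (_ : IsDomain W) (_ : IsDiscreteValuationRing W)
      (_ : CharZero W) (q : W →+* l),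
      Function.Surjective q ∧ RingHom.ker q = Ideal.span {(p : W)} := by
  let := ZMod.algebra l p
  obtain ⟨ι, x, hx⟩ := exists_isTranscendenceBasis' (ZMod p) l
  let K := AlgebraicClosure (FractionRing (MvPolynomial ι ℤ))
  let i₀ : MvPolynomial ι ℤ →+* K :=
    (algebraMap (FractionRing (MvPolynomial ι ℤ)) K).comp (algebraMap _ _)
  have hi₀ : Function.Injective i₀ :=
    (algebraMap (FractionRing (MvPolynomial ι ℤ)) K).injective.comp
      (IsFractionRing.injective (MvPolynomial ι ℤ) (FractionRing (MvPolynomial ι ℤ)))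
  have : CharZero K := ⟨fun a b hab ↦ by
    rw [← map_natCast i₀, ← map_natCast i₀] at hab
    exact Nat.cast_injective (hi₀ hab)⟩
  have h₀ := (isUnramifiedPair_mvPolynomial_int hx.1 hi₀).range
  obtain ⟨Γ, hle, hΓ⟩ := zorn_le_nonempty₀ {Γ : Subring (K × l) | Γ.IsUnramified p}
    (fun c hc hchain y hy ↦ ⟨sSup c, Subring.IsUnramified.of_isChain hc hchain ⟨y, hy⟩,
      fun z hz ↦ le_sSup hz⟩) _ h₀
  let i : Γ →+* K := (RingHom.fst K l).comp Γ.subtype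
  let q : Γ →+* l := (RingHom.snd K l).comp Γ.subtype
  have hpair : IsUnramifiedPair p i q := hΓ.1
  have hi : Function.Injective i := by
    rw [injective_iff_map_eq_zero]
    intro a ha
    exact Subtype.ext (Prod.ext ha (hpair.1 a ha))
  have hu : ∀ w, q w ≠ 0 → IsUnit w := fun w hw ↦
    IsUnit.of_mul_eq_one ⟨_, Subring.IsUnramified.inv_mem hΓ w.2 hw⟩ (Subtype.ext (Prod.ext
      (mul_inv_cancel₀ (Subring.IsUnramified.fst_ne_zero hΓ.1 w.2 hw)) (mul_inv_cancel₀ hw)))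
  have : IsDomain Γ := hi.isDomain i
  have hdvr := hpair.isDiscreteValuationRing hi hu
  refine ⟨Γ, inferInstance, inferInstance, hdvr,
    ⟨fun a b hab ↦ by simpa using congr_arg i hab⟩, q, fun α ↦ ?_,
    hpair.ker_eq_span hi⟩
  have : Algebra.IsAlgebraic (Algebra.adjoin (ZMod p) (Set.range x)) l := hx.isAlgebraic
  obtain ⟨f, hf, hfα⟩ :=
    Algebra.IsAlgebraic.isAlgebraic (R := Algebra.adjoin (ZMod p) (Set.range x)) α
  have hlift : f.map (algebraMap _ l) ∈ Polynomial.lifts q := by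
    rw [Polynomial.lifts_iff_coeff_lifts]
    intro n
    rw [Polynomial.coeff_map]
    have hmem : (f.coeff n : l) ∈ (MvPolynomial.aeval (R := ZMod p) x).range := by
      rw [← Algebra.adjoin_range_eq_range_aeval]
      exact (f.coeff n).2
    obtain ⟨g, hg⟩ := hmem
    obtain ⟨g, rfl⟩ := MvPolynomial.map_surjective (Int.castRingHom (ZMod p))
      ZMod.intCast_surjective g
    refine ⟨⟨_, hle ⟨g, rfl⟩⟩, Eq.trans ?_ hg⟩
    change MvPolynomial.eval₂Hom (Int.castRingHom l) x g =
      MvPolynomial.aeval x (MvPolynomial.map (Int.castRingHom (ZMod p)) g)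
    rw [MvPolynomial.aeval_def, MvPolynomial.eval₂_map, MvPolynomial.coe_eval₂Hom]
    congr 1
    exact RingHom.ext_int _ _
  obtain ⟨G, hG⟩ := (Polynomial.mem_lifts _).mp hlift
  obtain ⟨θ, hθ⟩ := hpair.exists_eval₂RingHom hi hu (α := α) (G := G)
    (by rwa [hG, Ne, Polynomial.map_eq_zero_iff (FaithfulSMul.algebraMap_injective _ _)])
    (by rw [Polynomial.eval₂_eq_eval_map, hG, Polynomial.eval_map_algebraMap, hfα])
  have hle1 : Γ ≤ ((Polynomial.eval₂RingHom i θ).prod (Polynomial.eval₂RingHom q α)).range :=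
    fun y hy ↦ ⟨Polynomial.C ⟨y, hy⟩, by ext <;> simp [i, q]⟩
  have heq := hΓ.eq_of_le hθ.range hle1
  have hmem : (θ, α) ∈ Γ := by
    rw [heq]
    exact ⟨Polynomial.X, by ext <;> simp⟩
  exact ⟨⟨_, hmem⟩, rfl⟩

end CohenRing

section LiftCohenRing

lemma RingHom.FormallySmooth.exists_lift {R S A C : Type*} [CommRing R] [CommRing S] [CommRing A]
    [CommRing C] {f : R →+* S} (hf : f.FormallySmooth) (a : R →+* A) {π : A →+* C}
    (hπ : Function.Surjective π) (hnil : IsNilpotent (RingHom.ker π)) (s : S →+* C)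
    (h : s.comp f = π.comp a) : ∃ g : S →+* A, π.comp g = s := by
  algebraize [f, a, π.comp a]
  let s' : S →ₐ[R] C := { s with commutes' := fun r ↦ RingHom.congr_fun h r }
  let π' : A →ₐ[R] C := { π with commutes' := fun r ↦ rfl }
  exact ⟨(Algebra.FormallySmooth.liftOfSurjective s' π' hπ hnil).toRingHom,
    RingHom.ext fun x ↦ Algebra.FormallySmooth.liftOfSurjective_apply s' π' hπ hnil x⟩

lemma formallySmooth_quotient_sq {R S : Type*} [CommRing R] [CommRing S] [Algebra R S]
    [Module.Flat R S] (I : Ideal R)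
    (h : Algebra.FormallySmooth (R ⧸ I) (S ⧸ I.map (algebraMap R S))) :
    Algebra.FormallySmooth (R ⧸ I ^ 2) (S ⧸ (I ^ 2).map (algebraMap R S)) := by
  have hle : I ^ 2 ≤ I := Ideal.pow_le_self two_ne_zero
  have hflat : Module.Flat (R ⧸ I ^ 2) (S ⧸ (I ^ 2).map (algebraMap R S)) :=
    .of_linearEquiv (Algebra.TensorProduct.quotIdealMapEquivQuotTensor S (I ^ 2)).toLinearEquiv
  rw [← RingHom.formallySmooth_algebraMap]
  refine RingHom.FormallySmooth.of_flat_of_ker_eq_map_of_square_zero _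
    (RingHom.flat_algebraMap_iff.mpr hflat) (Ideal.Quotient.factor hle)
    (Ideal.Quotient.factor (Ideal.map_mono hle)) (algebraMap (R ⧸ I) (S ⧸ I.map (algebraMap R S)))
    (Ideal.Quotient.factor_surjective _) (Ideal.Quotient.factor_surjective _) ?_ ?_ ?_
    (RingHom.formallySmooth_algebraMap.mpr h)
  · exact Ideal.Quotient.ringHom_ext rfl
  · rw [Ideal.Quotient.factor_ker, ← Ideal.map_pow, Ideal.map_quotient_self]
  · rw [Ideal.Quotient.factor_ker, Ideal.Quotient.factor_ker, Ideal.map_map, Ideal.map_map]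
    rfl

lemma formallySmooth_quotient_pow {R S : Type*} [CommRing R] [CommRing S] [Algebra R S]
    [Module.Flat R S] (I : Ideal R)
    (h : Algebra.FormallySmooth (R ⧸ I) (S ⧸ I.map (algebraMap R S))) (k : ℕ) :
    Algebra.FormallySmooth (R ⧸ I ^ 2 ^ k) (S ⧸ (I ^ 2 ^ k).map (algebraMap R S)) := by
  induction k with
  | zero => rw [pow_zero, pow_one]; exact h
  | succ k ih =>
    rw [pow_succ 2 k, pow_mul]
    exact formallySmooth_quotient_sq _ ih

/-- Cohen rings lift along nilpotent extensions of their residue field. -/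
lemma exists_ringHom_of_ker_eq_span {p : ℕ} [Fact p.Prime] {W l A : Type*} [CommRing W] [IsDomain W]
    [CharZero W] [Field l] [CharP l p] [CommRing A] {q : W →+* l} (hq : Function.Surjective q)
    (hker : RingHom.ker q = Ideal.span {(p : W)}) {π : A →+* l} (hπ : Function.Surjective π)
    (hnil : IsNilpotent (RingHom.ker π)) : ∃ g : W →+* A, π.comp g = q := by
  obtain ⟨N, hN⟩ := hnil
  let I : Ideal ℤ := Ideal.span {(p : ℤ)}
  have hI : I.map (algebraMap ℤ W) = RingHom.ker q := by
    rw [hker, Ideal.map_span, Set.image_singleton, map_natCast]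
  have hflat : Module.Flat ℤ W := inferInstance
  let := ZMod.algebra l p
  have hbase : Algebra.FormallySmooth (ℤ ⧸ I) (W ⧸ I.map (algebraMap ℤ W)) := by
    have h1 := formallySmooth_of_perfectField (ZMod p) l
    let e : W ⧸ I.map (algebraMap ℤ W) ≃+* l :=
      (Ideal.quotEquivOfEq hI).trans (RingHom.quotientKerEquivOfSurjective hq)
    have h2 : (algebraMap (ℤ ⧸ I) (W ⧸ I.map (algebraMap ℤ W))) =
        (e.symm : l →+* _).comp ((algebraMap (ZMod p) l).comp
          (Int.quotientSpanNatEquivZMod p : ℤ ⧸ I →+* ZMod p)) :=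
      Ideal.Quotient.ringHom_ext (RingHom.ext_int _ _)
    rw [← RingHom.formallySmooth_algebraMap, h2]
    refine RingHom.FormallySmooth.comp (RingHom.FormallySmooth.comp ?_
      (RingHom.formallySmooth_algebraMap.mpr h1)) ?_
    · exact .of_bijective (Int.quotientSpanNatEquivZMod p).bijective
    · exact .of_bijective e.symm.bijective
  have hk := RingHom.formallySmooth_algebraMap.mpr (formallySmooth_quotient_pow I hbase N)
  have hpA : ((p : ℕ) : A) ^ 2 ^ N = 0 := by
    have h1 : (p : A) ∈ RingHom.ker π := by
      rw [RingHom.mem_ker, map_natCast, CharP.cast_eq_zero]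
    have h2 := Ideal.pow_mem_pow h1 N
    rw [hN] at h2
    exact pow_eq_zero_of_le (Nat.lt_two_pow_self).le h2
  have hqI : ∀ a ∈ (I ^ 2 ^ N).map (algebraMap ℤ W), q a = 0 := by
    intro a ha
    rw [← RingHom.mem_ker, ← hI]
    exact Ideal.map_mono (Ideal.pow_le_self (by positivity)) ha
  obtain ⟨g, hg⟩ := hk.exists_lift (Ideal.Quotient.lift (I ^ 2 ^ N) (Int.castRingHom A) (by
      intro a ha
      rw [Ideal.span_singleton_pow, Ideal.mem_span_singleton] at ha
      obtain ⟨b, rfl⟩ := ha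
      simp [hpA])) hπ ⟨N, hN⟩ (Ideal.Quotient.lift _ q hqI)
    (Ideal.Quotient.ringHom_ext (RingHom.ext_int _ _))
  refine ⟨g.comp (Ideal.Quotient.mk _), ?_⟩
  rw [← RingHom.comp_assoc, hg]
  rfl

/-- An Artinian local ring receives a map from a discrete valuation ring that is surjective on
residue fields. -/
theorem exists_isDiscreteValuationRing_ringHom (A : Type u) [CommRing A] [IsLocalRing A]
    [IsArtinianRing A] :
    ∃ (W : Type u) (_ : CommRing W) (_ : IsDomain W) (_ : IsDiscreteValuationRing W)
      (g : W →+* A), Function.Surjective ((residue A).comp g) := by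
  have hnil : IsNilpotent (RingHom.ker (residue A)) := by
    rw [ker_residue]
    exact isArtinianRing_iff_isNilpotent_maximalIdeal A |>.mp inferInstance
  obtain ⟨p, hp⟩ := CharP.exists (ResidueField A)
  rcases CharP.char_is_prime_or_zero (ResidueField A) p with hpp | rfl
  · have : Fact p.Prime := ⟨hpp⟩
    obtain ⟨W, _, _, _, _, q, hq, hker⟩ := exists_cohenRing p (ResidueField A)
    obtain ⟨g, hg⟩ := exists_ringHom_of_ker_eq_span hq hker residue_surjective hnil
    exact ⟨W, inferInstance, inferInstance, inferInstance, g, hg ▸ hq⟩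
  · have : CharZero (ResidueField A) := CharP.charP_to_charZero _
    have hunit : ∀ n : nonZeroDivisors ℤ, IsUnit (Int.castRingHom A n) := by
      intro n
      refine isUnit_of_map_unit (residue A) _ (IsUnit.mk0 _ ?_)
      rw [eq_intCast, map_intCast, Int.cast_ne_zero]
      exact nonZeroDivisors.ne_zero n.2
    have hsm := RingHom.formallySmooth_algebraMap.mpr
      (formallySmooth_of_perfectField ℚ (ResidueField A))
    obtain ⟨g, hg⟩ := hsm.exists_lift (IsLocalization.lift hunit : ℚ →+* A)
      residue_surjective hnil (RingHom.id _) (Subsingleton.elim _ _)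
    refine ⟨PowerSeries (ResidueField A), inferInstance, inferInstance, inferInstance,
      g.comp PowerSeries.constantCoeff, ?_⟩
    rw [← RingHom.comp_assoc, hg, RingHom.id_comp]
    exact PowerSeries.constantCoeff_surj

end LiftCohenRing

section CohenStructure

lemma RingHom.surjective_of_isNilpotent_map {B A : Type*} [CommRing B] [CommRing A] (φ : B →+* A)
    (I : Ideal B) (hnil : IsNilpotent (I.map φ)) (h : ∀ a, ∃ b, a - φ b ∈ I.map φ) :
    Function.Surjective φ := by
  have hstep : ∀ k, ∀ y ∈ I.map φ ^ k, ∃ b ∈ I ^ k, y - φ b ∈ I.map φ ^ (k + 1) := by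
    intro k y hy
    rw [← Ideal.map_pow] at hy
    induction hy using Submodule.span_induction with
    | mem y hy =>
      obtain ⟨b, hb, rfl⟩ := hy
      exact ⟨b, hb, by simp⟩
    | zero => exact ⟨0, zero_mem _, by simp⟩
    | add y z _ _ hy hz =>
      obtain ⟨b, hb, hb'⟩ := hy
      obtain ⟨c, hc, hc'⟩ := hz
      refine ⟨b + c, add_mem hb hc, ?_⟩
      rw [map_add, add_sub_add_comm]
      exact add_mem hb' hc'
    | smul a y _ hy =>
      obtain ⟨b, hb, hb'⟩ := hy
      obtain ⟨c, hc⟩ := h a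
      refine ⟨c * b, Ideal.mul_mem_left _ _ hb, ?_⟩
      have h1 : (a - φ c) * φ b ∈ I.map φ ^ (k + 1) := by
        rw [pow_succ']
        exact Ideal.mul_mem_mul hc (by rw [← Ideal.map_pow]; exact Ideal.mem_map_of_mem _ hb)
      have h2 := add_mem (Ideal.mul_mem_left _ a hb') h1
      convert h2 using 1
      rw [smul_eq_mul, map_mul]
      ring
  have hall : ∀ k, ∀ a, ∃ b, a - φ b ∈ I.map φ ^ k := by
    intro k
    induction k with
    | zero => exact fun a ↦ ⟨0, by simp⟩
    | succ k ih =>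
      intro a
      obtain ⟨b, hb⟩ := ih a
      obtain ⟨c, -, hc⟩ := hstep k _ hb
      exact ⟨b + c, by rwa [map_add, ← sub_sub]⟩
  obtain ⟨n, hn⟩ := hnil
  intro a
  obtain ⟨b, hb⟩ := hall n a
  rw [hn] at hb
  exact ⟨b, (sub_eq_zero.mp hb).symm⟩

lemma spanFinrank_maximalIdeal_le_of_surjective {B A : Type*} [CommRing B] [CommRing A]
    [IsLocalRing B] [IsLocalRing A] [IsNoetherianRing B] (φ : B →+* A)
    (hφ : Function.Surjective φ) :
    (maximalIdeal A).spanFinrank ≤ (maximalIdeal B).spanFinrank := by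
  conv_lhs => rw [← map_maximalIdeal_of_surjective φ hφ]
  exact Ideal.spanFinrank_map_le_of_fg _ (maximalIdeal B).fg_of_isNoetherianRing

lemma MvPolynomial.sub_C_constantCoeff_mem {σ R : Type*} [CommRing R] (f : MvPolynomial σ R) :
    f - C (constantCoeff f) ∈ Ideal.span (Set.range (X : σ → MvPolynomial σ R)) := by
  induction f using MvPolynomial.induction_on with
  | C a => simp
  | add p q hp hq =>
    rw [map_add, map_add, add_sub_add_comm]
    exact add_mem hp hq
  | mul_X p i hp =>
    rw [map_mul, constantCoeff_X, mul_zero, map_zero, sub_zero]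
    exact Ideal.mul_mem_left _ _ (Ideal.subset_span ⟨i, rfl⟩)

/-- An Artinian local ring is a quotient of a regular local ring of the same embedding
dimension. -/
theorem exists_isRegularLocalRing_surjective (A : Type u) [CommRing A] [IsLocalRing A]
    [IsArtinianRing A] :
    ∃ (Q : Type u) (_ : CommRing Q) (_ : IsRegularLocalRing Q) (π : Q →+* A),
      Function.Surjective π ∧ (maximalIdeal Q).spanFinrank = (maximalIdeal A).spanFinrank := by
  obtain ⟨W, _, _, _, g, hg⟩ := exists_isDiscreteValuationRing_ringHom A
  obtain ⟨ϖ, hϖ⟩ := IsDiscreteValuationRing.exists_irreducible W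
  obtain ⟨s, hcard, hs⟩ := Submodule.FG.exists_span_finset_card_eq_spanFinrank
    (maximalIdeal A).fg_of_isNoetherianRing
  have hgker : ∀ w, g w ∈ maximalIdeal A ↔ w ∈ maximalIdeal W := by
    intro w
    have hmax : (RingHom.ker ((residue A).comp g)).IsMaximal :=
      RingHom.ker_isMaximal_of_surjective _ hg
    rw [← eq_maximalIdeal hmax, RingHom.mem_ker, RingHom.comp_apply, residue_eq_zero_iff]
  let ev : MvPolynomial s W →+* A := MvPolynomial.eval₂Hom g Subtype.val
  have hevC : ∀ w, ev (MvPolynomial.C w) = g w := MvPolynomial.eval₂Hom_C _ _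
  have hevX : ∀ i, ev (MvPolynomial.X i) = i := MvPolynomial.eval₂Hom_X' _ _
  let P : Ideal (MvPolynomial s W) := (maximalIdeal A).comap ev
  let V : Ideal (MvPolynomial s W) := Ideal.span (Set.range MvPolynomial.X)
  have hVmap : V.map ev = maximalIdeal A := by
    rw [Ideal.map_span, ← Set.range_comp, ← hs]
    congr 1
    ext a
    simp [hevX]
  have hVP : V ≤ P := by
    rw [← Ideal.map_le_iff_le_comap, hVmap]
  have hPmap : P.map ev = maximalIdeal A :=
    le_antisymm Ideal.map_comap_le (hVmap.ge.trans (Ideal.map_mono hVP))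
  have hnil := (isArtinianRing_iff_isNilpotent_maximalIdeal A).mp inferInstance
  have hev : Function.Surjective ev := by
    refine RingHom.surjective_of_isNilpotent_map ev P (hPmap ▸ hnil) fun a ↦ ?_
    obtain ⟨w, hw⟩ := hg (residue A a)
    refine ⟨MvPolynomial.C w, ?_⟩
    rw [hPmap, ← residue_eq_zero_iff, map_sub, ← hw, hevC, RingHom.comp_apply, sub_self]
  have hPmem : ∀ f : MvPolynomial s W, f ∈ P ↔ MvPolynomial.constantCoeff f ∈ maximalIdeal W := by
    intro f
    have h1 := hVP (MvPolynomial.sub_C_constantCoeff_mem f)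
    have h2 : MvPolynomial.C (MvPolynomial.constantCoeff f) ∈ P ↔
        MvPolynomial.constantCoeff f ∈ maximalIdeal W := by
      rw [← hgker, Ideal.mem_comap, hevC]
    rw [← h2]
    exact ⟨fun hf ↦ by simpa using sub_mem hf h1, fun hc ↦ by simpa using add_mem h1 hc⟩
  let L := Localization.AtPrime P
  let π : L →+* A := IsLocalization.lift (M := P.primeCompl) (g := ev) fun y ↦ by
    by_contra hc
    exact y.2 ((mem_maximalIdeal _).mpr hc)
  let ρ : L →+* W := IsLocalization.lift (M := P.primeCompl) (g := MvPolynomial.constantCoeff)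
    fun y ↦ by
      by_contra hc
      exact y.2 ((hPmem _).mpr ((mem_maximalIdeal _).mpr hc))
  have hπM : ∀ f, π (algebraMap (MvPolynomial s W) L f) = ev f := IsLocalization.lift_eq _
  have hρM : ∀ f, ρ (algebraMap (MvPolynomial s W) L f) = MvPolynomial.constantCoeff f :=
    IsLocalization.lift_eq _
  have hL : maximalIdeal L = P.map (algebraMap (MvPolynomial s W) L) :=
    Localization.AtPrime.map_eq_maximalIdeal.symm
  have hρL : (maximalIdeal L).map ρ ≤ maximalIdeal W := by
    rw [hL, Ideal.map_map, Ideal.map_le_iff_le_comap]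
    intro f hf
    rw [Ideal.mem_comap, RingHom.comp_apply, hρM]
    exact (hPmem f).mp hf
  have hϖA : g ϖ ∈ maximalIdeal A := (hgker ϖ).mpr ((mem_maximalIdeal _).mpr hϖ.not_isUnit)
  obtain ⟨v, hv, hvϖ⟩ : ∃ v ∈ V, ev v = g ϖ := by
    rwa [← hVmap, Ideal.mem_map_iff_of_surjective ev hev] at hϖA
  have hvc : MvPolynomial.constantCoeff v = 0 := by
    have : V ≤ RingHom.ker MvPolynomial.constantCoeff := by
      rw [Ideal.span_le]
      rintro _ ⟨i, rfl⟩
      exact MvPolynomial.constantCoeff_X _ i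
    exact this hv
  let h : L := algebraMap (MvPolynomial s W) L (MvPolynomial.C ϖ - v)
  have hπh : π h = 0 := by
    rw [hπM, map_sub, hvϖ, hevC, sub_self]
  have hmem : h ∈ maximalIdeal L := by
    rw [hL]
    refine Ideal.mem_map_of_mem _ ((hPmem _).mpr ?_)
    rw [map_sub, hvc, sub_zero, MvPolynomial.constantCoeff_C]
    exact (mem_maximalIdeal _).mpr hϖ.not_isUnit
  have hsq : h ∉ maximalIdeal L ^ 2 := by
    intro hh
    have h1 := Ideal.pow_right_mono hρL 2 (Ideal.map_pow ρ _ 2 ▸ Ideal.mem_map_of_mem ρ hh)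
    rw [hρM, map_sub, hvc, sub_zero, MvPolynomial.constantCoeff_C, hϖ.maximalIdeal_eq,
      Ideal.span_singleton_pow, Ideal.mem_span_singleton] at h1
    obtain ⟨c, hc⟩ := h1
    refine hϖ.not_isUnit (IsUnit.of_mul_eq_one c (mul_left_cancel₀ hϖ.ne_zero ?_))
    rw [mul_one, ← mul_assoc, ← pow_two, ← hc]
  have hreg := IsRegularLocalRing.quotient_span_singleton hmem hsq
  have hloc := hreg.toIsLocalRing
  let π' : L ⧸ Ideal.span {h} →+* A := Ideal.Quotient.lift _ π fun a ha ↦ by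
    obtain ⟨b, rfl⟩ := Ideal.mem_span_singleton.mp ha
    rw [map_mul, hπh, zero_mul]
  have hπ' : Function.Surjective π' := Ideal.Quotient.lift_surjective_of_surjective _ _ fun a ↦ by
    obtain ⟨f, rfl⟩ := hev a
    exact ⟨_, hπM f⟩
  refine ⟨L ⧸ Ideal.span {h}, inferInstance, hreg, π', hπ', le_antisymm ?_ ?_⟩
  · let mkM : MvPolynomial s W →+* L ⧸ Ideal.span {h} :=
      (Ideal.Quotient.mk _).comp (algebraMap (MvPolynomial s W) L)
    have hmax : maximalIdeal (L ⧸ Ideal.span {h}) = V.map mkM := by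
      refine (map_maximalIdeal_of_surjective (Ideal.Quotient.mk (Ideal.span {h}))
        Ideal.Quotient.mk_surjective).symm.trans ?_
      rw [hL, Ideal.map_map]
      refine le_antisymm (Ideal.map_le_iff_le_comap.mpr fun f hf ↦ ?_) (Ideal.map_mono hVP)
      have hc : mkM (MvPolynomial.C ϖ) = mkM v := by
        rw [← sub_eq_zero, ← map_sub]
        exact Ideal.Quotient.eq_zero_iff_mem.mpr (Ideal.mem_span_singleton_self h)
      rw [hPmem, hϖ.maximalIdeal_eq, Ideal.mem_span_singleton] at hf
      obtain ⟨w, hw⟩ := hf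
      have h1 := Ideal.mem_map_of_mem mkM (MvPolynomial.sub_C_constantCoeff_mem f)
      rw [hw, map_sub, map_mul, map_mul, hc] at h1
      have h2 : mkM v * mkM (MvPolynomial.C w) ∈ V.map mkM := by
        rw [← map_mul]
        exact Ideal.mem_map_of_mem _ (Ideal.mul_mem_right _ _ hv)
      have h3 := add_mem h1 h2
      rwa [sub_add_cancel] at h3
    rw [hmax, ← hcard, Ideal.map_span]
    refine (Submodule.spanFinrank_span_le_ncard_of_finite (Set.toFinite _)).trans ?_
    rw [← Set.range_comp]
    exact (Finite.card_range_le _).trans (by simp)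
  · exact spanFinrank_maximalIdeal_le_of_surjective π' hπ'

end CohenStructure

section CompleteIntersection

/-- An Artinian local quotient `F = S / 𝔞` is a complete intersection if `𝔞` surjects onto a free
`F`-module of rank at least the embedding dimension of `S` minus one. -/
lemma isCompleteIntersectionLocalRing_quotient {S : Type u} [CommRing S] [IsLocalRing S]
    [IsNoetherianRing S] {𝔞 : Ideal S} [IsLocalRing (S ⧸ 𝔞)] (h0 : ringKrullDim (S ⧸ 𝔞) = 0) {n : ℕ}
    (hn : (maximalIdeal S).spanFinrank ≤ n + 1) (ψ : 𝔞 →ₗ[S] (Fin n → S ⧸ 𝔞))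
    (hψ : Function.Surjective ψ) : IsCompleteIntersectionLocalRing (S ⧸ 𝔞) := by
  have hle : 𝔞 ^ 2 ≤ 𝔞 := Ideal.pow_le_self two_ne_zero
  have h𝔞 : 𝔞 ≤ maximalIdeal S :=
    le_maximalIdeal ((Ideal.Quotient.nontrivial_iff).mp inferInstance)
  have : Ring.KrullDimLE 0 (S ⧸ 𝔞) := by
    rw [Ring.krullDimLE_iff, h0]; rfl
  have hart : IsArtinianRing (S ⧸ 𝔞) := isArtinianRing_iff_krullDimLE_zero.mpr this
  have hloc2 : IsLocalRing (S ⧸ 𝔞 ^ 2) := isLocalRing_quotient_of_le (hle.trans h𝔞)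
  have hart2 : IsArtinianRing (S ⧸ 𝔞 ^ 2) := by
    rw [isArtinianRing_iff_isNilpotent_maximalIdeal] at hart ⊢
    obtain ⟨k, hk⟩ := hart
    refine ⟨k * 2, ?_⟩
    rw [← map_maximalIdeal_of_surjective (Ideal.Quotient.mk 𝔞) Ideal.Quotient.mk_surjective,
      ← Ideal.map_pow, Ideal.zero_eq_bot, Ideal.map_eq_bot_iff_le_ker, Ideal.mk_ker] at hk
    rw [← map_maximalIdeal_of_surjective (Ideal.Quotient.mk (𝔞 ^ 2)) Ideal.Quotient.mk_surjective,
      ← Ideal.map_pow, Ideal.zero_eq_bot, Ideal.map_eq_bot_iff_le_ker, Ideal.mk_ker, pow_mul]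
    exact Ideal.pow_right_mono hk 2
  obtain ⟨Q, _, _, π, hπ, hQ⟩ := exists_isRegularLocalRing_surjective (S ⧸ 𝔞 ^ 2)
  have hQn : (maximalIdeal Q).spanFinrank ≤ n + 1 := by
    rw [hQ]
    exact (spanFinrank_maximalIdeal_le_of_surjective (Ideal.Quotient.mk (𝔞 ^ 2))
      Ideal.Quotient.mk_surjective).trans hn
  let := ((Ideal.Quotient.factor hle).comp π).toAlgebra
  have hsurj : Function.Surjective (algebraMap Q (S ⧸ 𝔞)) :=
    (Ideal.Quotient.factor_surjective hle).comp hπ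
  obtain ⟨rs, hrs, hker⟩ : ∃ rs : List Q, IsRegular Q rs ∧
      Ideal.ofList rs = RingHom.ker (algebraMap Q (S ⧸ 𝔞)) := by
    rcases hN : (maximalIdeal Q).spanFinrank with _ | N
    · let := (isField_of_spanFinrank_maximalIdeal_eq_zero hN).toField
      refine ⟨[], IsRegular.nil _ _, ?_⟩
      rw [Ideal.ofList_nil]
      exact ((RingHom.injective_iff_ker_eq_bot _).mp (algebraMap Q (S ⧸ 𝔞)).injective).symm
    · obtain ⟨φ, hφ⟩ := exists_surjective_ker_of_surjective_quotient_sq ψ hψ π hπ rfl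
      have hNn : N ≤ n := by omega
      refine exists_isRegular_ofList_eq_ker h0 N Q hsurj ?_ (N + 1) ?_
        ((LinearMap.funLeft Q (S ⧸ 𝔞) (Fin.castLE hNn)).comp φ)
        ((LinearMap.funLeft_surjective_of_injective Q (S ⧸ 𝔞) _ (Fin.castLE_injective hNn)).comp hφ)
      · rw [← (isRegularLocalRing_iff Q).mp inferInstance, hN]
      · have : Module.Finite Q (S ⧸ 𝔞) :=
          Module.Finite.of_surjective (Algebra.linearMap Q (S ⧸ 𝔞)) hsurj
        exact IsRegularLocalRing.hasProjectiveDimensionLE Q (N + 1) hN (S ⧸ 𝔞)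
  refine ⟨Q, inferInstance, inferInstance, rs, hrs, ⟨?_⟩⟩
  exact ((AdicCompletion.ofAlgEquiv (maximalIdeal (S ⧸ 𝔞))).symm.toRingEquiv.trans
    (RingHom.quotientKerEquivOfSurjective hsurj).symm).trans (Ideal.quotEquivOfEq hker.symm)

end CompleteIntersection

theorem mainTheorem9 {R : Type*} {S : Type*} [CommRing R] [CommRing S]
    [IsLocalRing R] [IsNoetherianRing R] [IsAdicComplete (IsLocalRing.maximalIdeal R) R]
    [IsLocalRing S] [IsNoetherianRing S] [IsAdicComplete (IsLocalRing.maximalIdeal S) S]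
    (f : R →+* S) [IsLocalHom f] (hflat : f.Flat)
    (hdim : ringKrullDim R = ringKrullDim S)
    (hedim : (embDim S : ℤ) - (embDim R : ℤ) ≤ 1) :
    IsCompleteIntersectionLocalRing (S ⧸ (IsLocalRing.maximalIdeal R).map f) := by
  algebraize [f]
  have hle : (maximalIdeal R).map (algebraMap R S) ≤ maximalIdeal S :=
    ((local_hom_TFAE (algebraMap R S)).out 0 2).mp ‹IsLocalHom f›
  have := isLocalRing_quotient_of_le hle
  obtain ⟨ψ, hψ⟩ := exists_surjective_map_maximalIdeal (R := R) (S := S)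
  have : IsLocalHom (algebraMap R S) := ‹IsLocalHom f›
  refine isCompleteIntersectionLocalRing_quotient (ringKrullDim_fiber_eq_zero hdim) ?_ ψ hψ
  unfold embDim at hedim
  omega
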